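/- **Setting.** Let $X=\mathbb A_{\mathbb Q}^\times/\mathbb Q^\times$ be the idele class group with a Haar measure $d^\times x$, let $(\pi(g)\Phi)(x)=\Phi(xg)$ be the right regular representation of $\mathbb A_{\mathbb Q}^\times$ on $L^2(X)$, and for $\Phi_0\in L^2(X)$ let $$\mathcal H_{\rm phys}=\overline{\operatorname{span}}\{\pi(g)\Phi_0: g\in\mathbb A_{\mathbb Q}^\times\}\subset L^2(X),\qquad \mathcal H^{(2)}_{\rm phys}=\mathcal H_{\rm phys}\oplus\mathcal H_{\rm phys}.$$ Let $U\in C^\infty(\mathbb R)$ be real-valued and $L$-periodic with $L>0$, let $E_*\in\mathbb R$, and put $$H_\infty=-\frac{d^2}{dy^2}+U(y),\quad D(H_\infty)=H^2(\mathbb R),\qquad Q_\infty=H_\infty-E_*I,\qquad D_\infty=\begin{pmatrix}0&Q_\infty\\Q_\infty&0\end{pmatrix}\ \text{ on } H^2(\mathbb R)\oplus H^2(\mathbb R).$$ Fix a complex Hilbert space $\mathcal H_{\rm fin}$ and a unitary identification $L^2(X)\cong L^2(\mathbb R,dy)\,\widehat\otimes\,\mathcal H_{\rm fin}$ (the result holds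 for every such choice), and let $D_{\rm glob}=D_\infty\,\widehat\otimes\, I_{\rm fin}$ in $L^2(X)\oplus L^2(X)$ be the closure of $D_\infty\otimes I_{\rm fin}$ on the algebraic tensor product $D(D_\infty)\otimes\mathcal H_{\rm fin}$. Assume that $\mathcal H^{(2)}_{\rm phys}$ is a reducing subspace for $D_{\rm glob}$ (the orthogonal projection $P$ onto it satisfies $P D_{\rm glob}\subseteq D_{\rm glob}P$), and write $D_{\rm glob}$ also for its part in $\mathcal H^{(2)}_{\rm phys}$. For each prime $p$ let $T_p$ be a bounded self-adjoint operator on $\mathcal H_{\rm phys}$, let $\eta_p:\mathbb R\to\mathbb R$ be a bounded Borel function with $\|\eta_p\|_\infty=\sup_{\lambda\in\mathbb R}|\eta_p(\lambda)|$, let $M_p=\eta_p(T_p)$ be given by the Borel functional calculus, and put $$\mathcal M_p=\begin{pmatrix}0&M_p\\M_p&0\end{pmatrix}\ \text{ on }\mathcal H^{(2)}_{\rm phys}.$$ For a closed operator $A$, $\operatorname{spec}_{\rm ess}(A)$ is the set of $z\in\mathbb C$ such that $A-z$ is not Fredholm; for self-adjoint $A$ this is the spectrum without the isolated eigenvalues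 of finite multiplicity. **Proposition (self-adjointness and essential spectrum).** The spherical Hecke operators on $\mathcal H_{\rm phys}$, $(T_p\Psi)(x)=\Psi(x\varpi_p)+\Psi(x\varpi_p^{-1})$, where $\varpi_p$ is the idele with component $p$ at the place $p$ and $1$ elsewhere, are bounded and self-adjoint, hence an admissible choice of $(T_p)$. For every choice of $(T_p)$ and $(\eta_p)$ as above, assume $\sum_p\|\eta_p\|_\infty<\infty$. Then: 1. the series $\mathcal M=\sum_p\mathcal M_p$ converges unconditionally in operator norm, and $\mathcal M$ is bounded and self-adjoint on $\mathcal H^{(2)}_{\rm phys}$; 2. $D_{\rm arith}:=D_{\rm glob}+\mathcal M$ with domain $D(D_{\rm arith})=D(D_{\rm glob})\subset\mathcal H^{(2)}_{\rm phys}$ is densely defined and self-adjoint; 3. if in addition each $M_p=\eta_p(T_p)$ is compact and $\sum_p\|M_p\|<\infty$, then $\mathcal M$ is compact and $$\operatorname{spec}_{\rm ess}(D_{\rm arith})=\operatorname{spec}_{\rm ess}(D_{\rm glob}).$$ -/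

import Mathlib

open MeasureTheory Filter Topology Set
open scoped RestrictedProduct TensorProduct InnerProductSpace ContDiff CompactlySupported

noncomputable section

namespace AdelicDirac

/-! ### Ideles, the space `L²(X)`, and Hecke operators -/

/-- The set of prime numbers. -/
abbrev PrimeNumber : Type := {p : ℕ // p.Prime}

instance primeNumberFact (p : PrimeNumber) : Fact (p.1.Prime) := ⟨p.2⟩

/-- The group `ℤ_p^×` of `p`-adic units inside `ℚ_p^×`. -/
def localUnits (p : PrimeNumber) : Subgroup ℚ_[p.1]ˣ where
  carrier := {u | ‖(u : ℚ_[p.1])‖ = 1}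
  mul_mem' := by
    intro a b ha hb
    simp only [mem_ofPred_eq, Units.val_mul, norm_mul] at *
    rw [ha, hb, one_mul]
  one_mem' := by simp
  inv_mem' := by
    intro a ha
    simp only [mem_ofPred_eq, Units.val_inv_eq_inv_val, norm_inv] at *
    rw [ha, inv_one]

instance localUnits_isOpen :
    Fact (∀ p : PrimeNumber, IsOpen (localUnits p : Set ℚ_[p.1]ˣ)) := by
  refine ⟨fun p => ?_⟩
  have h : IsOpen (Metric.sphere (0 : ℚ_[p.1]) 1) :=
    IsUltrametricDist.isOpen_sphere _ one_ne_zero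
  have h2 := h.preimage (Units.continuous_val (M := ℚ_[p.1]))
  convert h2 using 1
  ext u
  simp [localUnits]

instance localUnits_compactSpace (p : PrimeNumber) : CompactSpace (localUnits p) := by
  refine isCompact_iff_compactSpace.1 ?_
  have hc : IsClosedEmbedding (Units.embedProduct ℚ_[p.1]) := Units.isClosedEmbedding_embedProduct
  have hK : IsCompact ((Metric.closedBall (0 : ℚ_[p.1]) 1) ×ˢ
      (MulOpposite.unop ⁻¹' (Metric.closedBall (0 : ℚ_[p.1]) 1))) :=
    (isCompact_closedBall _ _).prod
      ((MulOpposite.opHomeomorph (M := ℚ_[p.1])).symm.isCompact_preimage.2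
        (isCompact_closedBall _ _))
  convert hc.isCompact_preimage hK using 1
  ext u
  have hu : 0 < ‖(u : ℚ_[p.1])‖ := norm_pos_iff.2 u.ne_zero
  simp only [mem_preimage, mem_prod, Units.embedProduct_apply,
    Metric.mem_closedBall, dist_zero_right, MulOpposite.unop_op, Units.val_inv_eq_inv_val, norm_inv]
  change ‖(u : ℚ_[p.1])‖ = 1 ↔ _
  constructor
  · intro h
    rw [h]; simp
  · rintro ⟨h1, h2⟩
    exact le_antisymm h1 ((inv_le_one₀ hu).1 h2)

/-- The finite ideles: the restricted product of the `ℚ_p^×` with respect to the `ℤ_p^×`. -/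
abbrev FiniteIdeles : Type := Πʳ p : PrimeNumber, [ℚ_[p.1]ˣ, localUnits p]

/-- The idele group of `ℚ`. -/
abbrev Ideles : Type := ℝˣ × FiniteIdeles

theorem eventually_mem_localUnits (q : ℚˣ) :
    ∀ᶠ p : PrimeNumber in cofinite,
      Units.map (algebraMap ℚ ℚ_[p.1]).toMonoidHom q ∈ localUnits p := by
  have hne : (q : ℚ).num.natAbs * (q : ℚ).den ≠ 0 := by simp
  have hfin : {p : PrimeNumber | p.1 ∣ (q : ℚ).num.natAbs * (q : ℚ).den}.Finite := by
    refine Set.Finite.of_finite_image (f := fun p : PrimeNumber => p.1) ?_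
      (Subtype.val_injective.injOn)
    refine ((q : ℚ).num.natAbs * (q : ℚ).den).divisors.finite_toSet.subset ?_
    rintro _ ⟨p, hp, rfl⟩
    exact Finset.mem_coe.2 (Nat.mem_divisors.2 ⟨hp, hne⟩)
  filter_upwards [hfin.compl_mem_cofinite] with p hp
  have hp' : ¬ p.1 ∣ (q : ℚ).num.natAbs * (q : ℚ).den := hp
  change ‖(algebraMap ℚ ℚ_[p.1] (q : ℚ))‖ = 1
  rw [Nat.Prime.dvd_mul p.2, not_or] at hp'
  have h1 : ‖(((q : ℚ).num : ℤ) : ℚ_[p.1])‖ = 1 := by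
    refine le_antisymm (Padic.norm_int_le_one _) (not_lt.1 fun h => hp'.1 ?_)
    exact Int.natCast_dvd.1 (Padic.norm_intCast_lt_one_iff.1 h)
  have h2 : ‖(((q : ℚ).den : ℕ) : ℚ_[p.1])‖ = 1 :=
    Padic.norm_natCast_eq_one_iff.2 ((Nat.Prime.coprime_iff_not_dvd p.2).2 hp'.2)
  have h3 : (algebraMap ℚ ℚ_[p.1] (q : ℚ)) = ((q : ℚ).num : ℚ_[p.1]) / ((q : ℚ).den : ℚ_[p.1]) := by
    rw [eq_ratCast]
    exact Rat.cast_def _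
  rw [h3, norm_div, h1, h2, div_one]

/-- The diagonal embedding of `ℚ^×` into the ideles. -/
def principalIdele : ℚˣ →* Ideles where
  toFun q := (Units.map (algebraMap ℚ ℝ).toMonoidHom q,
    ⟨fun p => Units.map (algebraMap ℚ ℚ_[p.1]).toMonoidHom q, eventually_mem_localUnits q⟩)
  map_one' := by
    refine Prod.ext (map_one _) (RestrictedProduct.ext _ _ fun p =>
      map_one (Units.map (algebraMap ℚ ℚ_[p.1]).toMonoidHom))
  map_mul' a b := by
    refine Prod.ext (map_mul _ _ _) (RestrictedProduct.ext _ _ fun p =>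
      map_mul (Units.map (algebraMap ℚ ℚ_[p.1]).toMonoidHom) a b)

/-- The idele class group `X`, the quotient of the ideles by `ℚ^×`. -/
abbrev IdeleClass : Type := Ideles ⧸ principalIdele.range

instance : MeasurableSpace IdeleClass := borel IdeleClass
instance : BorelSpace IdeleClass := ⟨rfl⟩

/-- Haar measure on `X` (unique up to a positive factor). -/
abbrev haarX : Measure IdeleClass := Measure.haar

/-- The adelic Hilbert space `L²(X)`. -/
abbrev L2X : Type := Lp ℂ 2 haarX

theorem haarX_right : haarX.IsMulRightInvariant := by
  refine ⟨fun g => ?_⟩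
  simp_rw [mul_comm _ g]
  exact map_mul_left_eq_self haarX g

/-- The right regular representation of the ideles on `L²(X)`: `(rho g Φ)(x) = Φ(x g)`. -/
def rho (g : Ideles) : L2X →ₗᵢ[ℂ] L2X :=
  Lp.compMeasurePreservingₗᵢ ℂ (fun x : IdeleClass => x * QuotientGroup.mk g)
    (haveI := haarX_right; measurePreserving_mul_right haarX _)

/-- The cyclic subspace of `L²(X)` generated by the seed `Φ₀`: the closed linear span of all
translates of `Φ₀`. -/
def HPhys (Φ₀ : L2X) : Submodule ℂ L2X :=
  (Submodule.span ℂ (Set.range fun g : Ideles => rho g Φ₀)).topologicalClosure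

instance (Φ₀ : L2X) : CompleteSpace (HPhys Φ₀) :=
  (Submodule.isClosed_topologicalClosure _).completeSpace_coe

theorem rho_mul (g h : Ideles) (f : L2X) : rho g (rho h f) = rho (g * h) f := by
  have := haarX_right
  unfold rho
  have := Lp.compMeasurePreserving_comp_apply (p := 2) f
    (measurePreserving_mul_right haarX (QuotientGroup.mk h : IdeleClass))
    (measurePreserving_mul_right haarX (QuotientGroup.mk g : IdeleClass))
  refine (this.symm.trans ?_)
  simp [Function.comp_def, mul_assoc]
  rfl

theorem map_mem_closure_span {E : Type*} [NormedAddCommGroup E] [InnerProductSpace ℂ E]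
    (S : Set E) (A : E →ₗᵢ[ℂ] E) (hA : ∀ x ∈ S, A x ∈ S) {f : E}
    (hf : f ∈ (Submodule.span ℂ S).topologicalClosure) :
    A f ∈ (Submodule.span ℂ S).topologicalClosure := by
  have h : (Submodule.span ℂ S).topologicalClosure ≤
      (Submodule.span ℂ S).topologicalClosure.comap A.toLinearMap := by
    refine Submodule.topologicalClosure_minimal _ ?_ ?_
    · rw [Submodule.span_le]
      intro x hx
      exact Submodule.le_topologicalClosure _ (Submodule.subset_span (hA x hx))
    · exact (Submodule.isClosed_topologicalClosure _).preimage A.continuous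
  exact h hf

theorem rho_mem (Φ₀ : L2X) (g : Ideles) {f : L2X} (hf : f ∈ HPhys Φ₀) : rho g f ∈ HPhys Φ₀ := by
  refine map_mem_closure_span _ (rho g) ?_ hf
  rintro _ ⟨h, rfl⟩
  exact ⟨g * h, (rho_mul g h Φ₀).symm⟩

/-- The idele with component `p` at the prime `p` and `1` at all other places. -/
def uniformizer (p : PrimeNumber) : Ideles :=
  (1, RestrictedProduct.mulSingle localUnits p (Units.mk0 (p.1 : ℚ_[p.1]) (by
    exact_mod_cast p.2.ne_zero)))

/-- The spherical Hecke operator at `p` on the cyclic space of `Φ₀`: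
`(T_p Ψ)(x) = Ψ(x p_p) + Ψ(x p_p⁻¹)`, where `p_p` is the idele with component `p` at `p`. On vectors
fixed by `ℤ_p^×` (so on the whole cyclic space, if the seed is unramified at `p`) this is the action
of the sum of the characteristic functions of `p ℤ_p^×` and `p⁻¹ ℤ_p^×`. -/
def heckeOperator (Φ₀ : L2X) (p : PrimeNumber) : HPhys Φ₀ →L[ℂ] HPhys Φ₀ :=
  ((rho (uniformizer p)).toContinuousLinearMap +
    (rho (uniformizer p)⁻¹).toContinuousLinearMap).restrict
    (p := HPhys Φ₀) (q := HPhys Φ₀)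
    fun _ hf => add_mem (rho_mem Φ₀ _ hf) (rho_mem Φ₀ _ hf)

/-! ### The Hill operator -/

/-- `L²(ℝ)` with complex values and Lebesgue measure. -/
abbrev L2R : Type := Lp ℂ 2 (volume : Measure ℝ)

/-- `g` is the weak derivative of `f`. -/
def IsWeakDeriv (f g : L2R) : Prop :=
  ∀ φ : ℝ → ℂ, ContDiff ℝ ∞ φ → HasCompactSupport φ →
    ∫ y, f y * deriv φ y = - ∫ y, g y * φ y

theorem integrable_mul_test (f : L2R) {φ : ℝ → ℂ} (hφ : Continuous φ) (hs : HasCompactSupport φ) :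
    Integrable (fun y => f y * φ y) :=
  MemLp.integrable_mul (p := 2) (q := 2) (Lp.memLp f) (hφ.memLp_of_hasCompactSupport hs)

theorem IsWeakDeriv.zero : IsWeakDeriv 0 0 := by
  intro φ _ _
  have h0 : ((0 : L2R) : ℝ → ℂ) =ᵐ[volume] 0 := Lp.coeFn_zero _ _ _
  have h1 : ∀ ψ : ℝ → ℂ, ∫ y, (0 : L2R) y * ψ y = 0 := fun ψ => by
    rw [← integral_zero ℝ ℂ]
    exact integral_congr_ae (h0.mono fun y hy => by simp)
  simp

theorem IsWeakDeriv.add {f g f' g' : L2R} (h : IsWeakDeriv f g) (h' : IsWeakDeriv f' g') :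
    IsWeakDeriv (f + f') (g + g') := by
  intro φ hφ hs
  have key : ∀ (a b : L2R) (ψ : ℝ → ℂ), Continuous ψ → HasCompactSupport ψ →
      ∫ y, (a + b : L2R) y * ψ y = (∫ y, a y * ψ y) + ∫ y, b y * ψ y := by
    intro a b ψ hψ hs
    rw [← integral_add (integrable_mul_test a hψ hs) (integrable_mul_test b hψ hs)]
    exact integral_congr_ae ((Lp.coeFn_add a b).mono fun y hy => by
      simp only [hy, Pi.add_apply, add_mul])
  rw [key f f' _ (hφ.continuous_deriv (by simp)) hs.deriv, key g g' _ hφ.continuous hs,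
    h φ hφ hs, h' φ hφ hs]
  ring

theorem IsWeakDeriv.smul {f g : L2R} (c : ℂ) (h : IsWeakDeriv f g) :
    IsWeakDeriv (c • f) (c • g) := by
  intro φ hφ hs
  have key : ∀ (a : L2R) (ψ : ℝ → ℂ), ∫ y, (c • a : L2R) y * ψ y = c * ∫ y, a y * ψ y := by
    intro a ψ
    rw [← integral_const_mul]
    exact integral_congr_ae ((Lp.coeFn_smul c a).mono fun y hy => by
      simp [hy, mul_assoc])
  rw [key, key, h φ hφ hs]
  ring

/-- The graph of `-d²/dy² + U` on `H²(ℝ)`: the pairs `(f, k)` such that `f` has weak derivatives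
`f' = g` and `f'' = h` in `L²(ℝ)` and `k = -h + U f`. -/
def hillGraph (U : ℝ → ℝ) : Submodule ℂ (L2R × L2R) where
  carrier := {q | ∃ g h : L2R, IsWeakDeriv q.1 g ∧ IsWeakDeriv g h ∧
    q.2 =ᵐ[volume] fun y => - h y + (U y : ℂ) * q.1 y}
  zero_mem' := by
    refine ⟨0, 0, IsWeakDeriv.zero, IsWeakDeriv.zero, ?_⟩
    have h0 : ((0 : L2R) : ℝ → ℂ) =ᵐ[volume] 0 := Lp.coeFn_zero _ _ _
    exact h0.mono fun y hy => by simp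
  add_mem' := by
    rintro a b ⟨g, h, h1, h2, h3⟩ ⟨g', h', h1', h2', h3'⟩
    refine ⟨g + g', h + h', h1.add h1', h2.add h2', ?_⟩
    filter_upwards [h3, h3', Lp.coeFn_add h h', Lp.coeFn_add a.1 b.1, Lp.coeFn_add a.2 b.2]
      with y e1 e2 e3 e4 e5
    simp only [Prod.snd_add, Prod.fst_add]
    rw [e3, e4, e5]
    simp only [Pi.add_apply]
    rw [e1, e2]
    ring
  smul_mem' := by
    rintro c a ⟨g, h, h1, h2, h3⟩
    refine ⟨c • g, c • h, h1.smul c, h2.smul c, ?_⟩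
    filter_upwards [h3, Lp.coeFn_smul c h, Lp.coeFn_smul c a.1, Lp.coeFn_smul c a.2]
      with y e1 e3 e4 e5
    simp only [Prod.smul_snd, Prod.smul_fst]
    rw [e3, e4, e5]
    simp only [Pi.smul_apply, smul_eq_mul]
    rw [e1]
    ring

theorem IsWeakDeriv.eq_zero {g : L2R} (h : IsWeakDeriv 0 g) : g = 0 := by
  have h0 : ((0 : L2R) : ℝ → ℂ) =ᵐ[volume] 0 := Lp.coeFn_zero _ _ _
  have h1 : ∀ ψ : ℝ → ℂ, ∫ y, (0 : L2R) y * ψ y = 0 := fun ψ => by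
    rw [← integral_zero ℝ ℂ]
    exact integral_congr_ae (h0.mono fun y hy => by simp)
  have h2 : ∀ᵐ y, g y = 0 := by
    refine ae_eq_zero_of_integral_contDiff_smul_eq_zero
      ((Lp.memLp g).locallyIntegrable (by norm_num)) ?_
    intro φ hφ hs
    have h3 := h (fun y => (φ y : ℂ)) (Complex.ofRealCLM.contDiff.comp hφ)
      (hs.comp_left (g := fun x : ℝ => (x : ℂ)) (by simp))
    rw [h1] at h3
    simpa [mul_comm, neg_eq_zero] using h3.symm
  exact Lp.ext (Filter.EventuallyEq.trans h2 h0.symm)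

theorem hillGraph_single_valued (U : ℝ → ℝ) (q : L2R × L2R) (hq : q ∈ hillGraph U)
    (h0 : q.1 = 0) : q.2 = 0 := by
  obtain ⟨g, h, h1, h2, h3⟩ := hq
  rw [h0] at h1
  have hg := h1.eq_zero
  rw [hg] at h2
  have hh := h2.eq_zero
  rw [h0, hh] at h3
  have hz : ((0 : L2R) : ℝ → ℂ) =ᵐ[volume] 0 := Lp.coeFn_zero _ _ _
  refine Lp.ext ?_
  filter_upwards [h3, hz] with y e1 e2
  rw [e1, e2]
  simp

/-- The Hill operator `H_∞ = -d²/dy² + U` in `L²(ℝ)`; for bounded measurable `U` its domain is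
`H²(ℝ)`. Its graph is single-valued by `hillGraph_single_valued`. -/
def hillOperator (U : ℝ → ℝ) : L2R →ₗ.[ℂ] L2R := (hillGraph U).toLinearPMap

/-- `Q_∞ = H_∞ - E_*`. -/
def qInf (U : ℝ → ℝ) (Estar : ℝ) : L2R →ₗ.[ℂ] L2R :=
  (-((Estar : ℂ) • LinearMap.id : L2R →ₗ[ℂ] L2R)) +ᵥ hillOperator U

/-! ### Operators in Hilbert spaces -/

section Abstract
variable {E : Type*} [NormedAddCommGroup E] [InnerProductSpace ℂ E]

/-- The orthogonal sum `E ⊕ E` of two copies of a Hilbert space. -/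
abbrev Double (E : Type*) : Type _ := WithLp 2 (E × E)

/-- The operator matrix with zero diagonal and both other entries equal to `A`,
`(f, g) ↦ (A g, A f)`, on `D(A) ⊕ D(A)`. -/
def chiral (A : E →ₗ.[ℂ] E) : Double E →ₗ.[ℂ] Double E where
  domain := (A.domain.prod A.domain).comap (WithLp.linearEquiv 2 ℂ (E × E)).toLinearMap
  toFun :=
    { toFun := fun x => WithLp.toLp 2 (A ⟨x.1.snd, x.2.2⟩, A ⟨x.1.fst, x.2.1⟩)
      map_add' := fun x y => by
        rw [← WithLp.toLp_add, Prod.mk_add_mk, ← A.map_add, ← A.map_add]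
        rfl
      map_smul' := fun c x => by
        rw [RingHom.id_apply, ← WithLp.toLp_smul, Prod.smul_mk, ← A.map_smul, ← A.map_smul]
        rfl }

/-- The same operator matrix for a bounded operator: `(f, g) ↦ (M g, M f)`. -/
def chiralCLM (M : E →L[ℂ] E) : Double E →L[ℂ] Double E :=
  (WithLp.prodContinuousLinearEquiv 2 ℂ E E).symm.toContinuousLinearMap ∘L
    ((M ∘L ContinuousLinearMap.snd ℂ E E).prod (M ∘L ContinuousLinearMap.fst ℂ E E)) ∘L
      (WithLp.prodContinuousLinearEquiv 2 ℂ E E).toContinuousLinearMap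

/-- The diagonal operator `(f, g) ↦ (M f, M g)`. -/
def diagCLM {F : Type*} [NormedAddCommGroup F] [InnerProductSpace ℂ F] (M : E →L[ℂ] F) :
    Double E →L[ℂ] Double F :=
  (WithLp.prodContinuousLinearEquiv 2 ℂ F F).symm.toContinuousLinearMap ∘L
    (M.prodMap M) ∘L (WithLp.prodContinuousLinearEquiv 2 ℂ E E).toContinuousLinearMap

/-- The essential spectrum of an unbounded operator: the `z` for which `A - z` is not Fredholm,
where Fredholm means finite-dimensional kernel and closed range of finite codimension. For
self-adjoint `A` this is the spectrum without the isolated eigenvalues of finite multiplicity. -/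
def essSpectrum (A : E →ₗ.[ℂ] E) : Set ℂ :=
  {z | ¬ (FiniteDimensional ℂ (LinearMap.ker (A.toFun - z • A.domain.subtype)) ∧
      IsClosed (LinearMap.range (A.toFun - z • A.domain.subtype) : Set E) ∧
      FiniteDimensional ℂ (E ⧸ LinearMap.range (A.toFun - z • A.domain.subtype)))}

/-- The orthogonal projection `P` commutes with `D`, that is `P D ⊆ D P`: the range of `P` is a
reducing subspace of `D`. -/
def IsReducedBy (P : E →L[ℂ] E) (D : E →ₗ.[ℂ] E) : Prop :=
  ∀ x : D.domain, ∃ h : P x ∈ D.domain, D ⟨P x, h⟩ = P (D x)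

/-- The Hilbert space tensor product: the completion of the algebraic one. -/
abbrev HilbertTensor (E K : Type*) [NormedAddCommGroup E] [InnerProductSpace ℂ E]
    [NormedAddCommGroup K] [InnerProductSpace ℂ K] : Type _ :=
  UniformSpace.Completion (E ⊗[ℂ] K)

/-- The part of `D` in a subspace `F`, embedded by `J`: its domain consists of the `x` in `F` with
`J x ∈ D(D)` and `D (J x)` in `F`, and it acts there as `D`. -/
def part {F : Type*} [NormedAddCommGroup F] [InnerProductSpace ℂ F] (J : F →L[ℂ] E)
    (D : E →ₗ.[ℂ] E) : F →ₗ.[ℂ] F :=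
  (D.graph.comap (J.prodMap J).toLinearMap).toLinearPMap

variable {K H : Type*} [NormedAddCommGroup K] [InnerProductSpace ℂ K]
  [NormedAddCommGroup H] [InnerProductSpace ℂ H]

/-- The elementary tensor `ψ ⊗ k` of `ψ = (ψ₁, ψ₂) ∈ E ⊕ E` and `k ∈ K`, as the element
`(ψ₁ ⊗ k, ψ₂ ⊗ k)` of `H ⊕ H`, where `H` is identified with the tensor product of `E` and `K`
by the unitary `W`. -/
def pureTensor (W : H ≃ₗᵢ[ℂ] HilbertTensor E K) (ψ : Double E) (k : K) : Double H :=
  WithLp.toLp 2 (W.symm ↑(ψ.fst ⊗ₜ[ℂ] k), W.symm ↑(ψ.snd ⊗ₜ[ℂ] k))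

/-- The operator `D ⊗ I` in `H ⊕ H`, where `H` is identified with the tensor product of `E` and
`K`: the closure of the operator `ψ ⊗ k ↦ (D ψ) ⊗ k` on the span of the `ψ ⊗ k` with
`ψ ∈ D(D)` and `k ∈ K`. -/
def tensorId (W : H ≃ₗᵢ[ℂ] HilbertTensor E K) (D : Double E →ₗ.[ℂ] Double E) :
    Double H →ₗ.[ℂ] Double H :=
  (Submodule.span ℂ (Set.range fun q : D.domain × K =>
    (pureTensor W q.1 q.2, pureTensor W (D q.1) q.2))).topologicalClosure.toLinearPMap

end Abstract

/-! ### Borel functional calculus -/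

section BorelCalculus

variable {H : Type*} [NormedAddCommGroup H] [InnerProductSpace ℂ H] [CompleteSpace H]

/-- The positive functional `f ↦ ⟨x, f(T) x⟩` on continuous functions of compact support, for a
bounded self-adjoint operator `T`; `f(T)` is given by the continuous functional calculus. -/
def spectralFunctional (T : H →L[ℂ] H) (x : H) : C_c(ℝ, ℝ) →ₚ[ℝ] ℝ :=
  PositiveLinearMap.mk₀
    { toFun := fun f => (⟪x, cfc (f : ℝ → ℝ) T x⟫_ℂ).re
      map_add' := fun f g => by
        have h : cfc ((f + g : C_c(ℝ, ℝ)) : ℝ → ℝ) T = cfc (f : ℝ → ℝ) T + cfc (g : ℝ → ℝ) T :=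
          cfc_add (a := T) f g f.continuous.continuousOn g.continuous.continuousOn
        rw [h, add_apply, inner_add_right, Complex.add_re]
      map_smul' := fun c f => by
        have h : cfc ((c • f : C_c(ℝ, ℝ)) : ℝ → ℝ) T = c • cfc (f : ℝ → ℝ) T :=
          cfc_smul c f T f.continuous.continuousOn
        simp only [h, smul_apply, RingHom.id_apply, smul_eq_mul]
        rw [← Complex.coe_smul, inner_smul_right, Complex.re_ofReal_mul] }
    (fun f hf => by
      have h : (0 : H →L[ℂ] H) ≤ cfc (f : ℝ → ℝ) T := cfc_nonneg fun y _ => hf y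
      have h2 := ((ContinuousLinearMap.nonneg_iff_isPositive _).1 h).re_inner_nonneg_right x
      exact h2)

/-- The spectral measure of the self-adjoint operator `T` at the vector `x`. -/
def spectralMeasure (T : H →L[ℂ] H) (x : H) : Measure ℝ :=
  RealRMK.rieszMeasure (spectralFunctional T x)

theorem integral_spectralMeasure (T : H →L[ℂ] H) (x : H) (f : C_c(ℝ, ℝ)) :
    ∫ t, f t ∂(spectralMeasure T x) = (⟪x, cfc (f : ℝ → ℝ) T x⟫_ℂ).re :=
  RealRMK.integral_rieszMeasure _ f

theorem spectralMeasure_univ_le (T : H →L[ℂ] H) (x : H) :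
    spectralMeasure T x univ ≤ ENNReal.ofReal (‖x‖ ^ 2) := by
  have hK : ∀ n : ℕ, spectralMeasure T x (Metric.closedBall 0 n) ≤ ENNReal.ofReal (‖x‖ ^ 2) := by
    intro n
    obtain ⟨f, h1, -, h2, h3⟩ := exists_continuous_one_zero_of_isCompact
      (isCompact_closedBall (0 : ℝ) n) isClosed_empty (by simp)
    have h4 := RealRMK.rieszMeasure_le_of_eq_one (spectralFunctional T x) (f := ⟨f, h2⟩)
      (fun t => (h3 t).1) (isCompact_closedBall (0 : ℝ) n) (fun t ht => h1 ht)
    refine h4.trans (ENNReal.ofReal_le_ofReal ?_)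
    change (⟪x, cfc (f : ℝ → ℝ) T x⟫_ℂ).re ≤ _
    have h5 : ‖cfc (f : ℝ → ℝ) T‖ ≤ 1 := norm_cfc_le zero_le_one fun t _ => by
      rw [Real.norm_of_nonneg (h3 t).1]
      exact (h3 t).2
    calc (⟪x, cfc (f : ℝ → ℝ) T x⟫_ℂ).re ≤ ‖⟪x, cfc (f : ℝ → ℝ) T x⟫_ℂ‖ := Complex.re_le_norm _
      _ ≤ ‖x‖ * ‖cfc (f : ℝ → ℝ) T x‖ := norm_inner_le_norm _ _
      _ ≤ ‖x‖ * (1 * ‖x‖) := by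
        gcongr
        exact (cfc (f : ℝ → ℝ) T).le_of_opNorm_le h5 x
      _ = ‖x‖ ^ 2 := by ring
  have hU : (⋃ n : ℕ, Metric.closedBall (0 : ℝ) n) = univ := Metric.iUnion_closedBall_nat 0
  rw [← hU, Monotone.measure_iUnion]
  · exact iSup_le hK
  · intro m n hmn
    exact Metric.closedBall_subset_closedBall (by exact_mod_cast hmn)

instance (T : H →L[ℂ] H) (x : H) : IsFiniteMeasure (spectralMeasure T x) :=
  ⟨(spectralMeasure_univ_le T x).trans_lt ENNReal.ofReal_lt_top⟩

/-- The quadratic form `x ↦ ∫ η dμ_x`. -/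
def spectralForm (T : H →L[ℂ] H) (η : ℝ → ℝ) (x : H) : ℝ := ∫ t, η t ∂(spectralMeasure T x)

theorem abs_spectralForm_le (T : H →L[ℂ] H) {η : ℝ → ℝ} {C : ℝ}
    (hC : ∀ t, |η t| ≤ C) (x : H) : |spectralForm T η x| ≤ C * ‖x‖ ^ 2 := by
  have h := norm_integral_le_of_norm_le_const (μ := spectralMeasure T x) (f := η)
    (Eventually.of_forall fun t => hC t)
  refine h.trans ?_
  have hC0 : 0 ≤ C := (abs_nonneg _).trans (hC 0)
  gcongr
  exact ENNReal.toReal_le_of_le_ofReal (by positivity) (spectralMeasure_univ_le T x)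

theorem integrable_spectralMeasure (T : H →L[ℂ] H) {η : ℝ → ℝ} (hη : Measurable η) {C : ℝ}
    (hC : ∀ t, |η t| ≤ C) (x : H) : Integrable η (spectralMeasure T x) :=
  Integrable.of_bound hη.aestronglyMeasurable C (Eventually.of_forall hC)

/-- Linear relations between the forms `x ↦ re ⟪x, A x⟫`, valid for every bounded `A`, pass to
the spectral form. -/
theorem spectralForm_relation (T : H →L[ℂ] H) {η : ℝ → ℝ} (hη : Measurable η) {C : ℝ}
    (hC : ∀ t, |η t| ≤ C) {n : ℕ} (c : Fin n → ℝ) (v : Fin n → H)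
    (h : ∀ A : H →L[ℂ] H, ∑ i, c i * (⟪v i, A (v i)⟫_ℂ).re = 0) :
    ∑ i, c i * spectralForm T η (v i) = 0 := by
  have key : ∀ (d : Fin n → NNReal) (g : ℝ → ℝ), (∀ i, Integrable g (spectralMeasure T (v i))) →
      ∫ t, g t ∂(∑ i, d i • spectralMeasure T (v i)) =
        ∑ i, (d i : ℝ) * ∫ t, g t ∂(spectralMeasure T (v i)) := by
    intro d g hg
    rw [integral_finsetSum_measure]
    · refine Finset.sum_congr rfl fun i _ => ?_
      rw [integral_smul_nnreal_measure]
      rfl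
    · intro i _
      exact (hg i).smul_measure_nnreal
  have hd : ∀ i, c i = ((c i).toNNReal : ℝ) - ((-c i).toNNReal : ℝ) := fun i => by
    simp only [Real.coe_toNNReal']
    exact (max_zero_sub_max_neg_zero_eq_self (c i)).symm
  have hsplit : ∀ w : Fin n → ℝ, ∑ i, c i * w i =
      (∑ i, ((c i).toNNReal : ℝ) * w i) - ∑ i, ((-c i).toNNReal : ℝ) * w i := by
    intro w
    rw [← Finset.sum_sub_distrib]
    refine Finset.sum_congr rfl fun i _ => ?_
    nth_rewrite 1 [hd i]
    ring
  have hμ : (∑ i, (c i).toNNReal • spectralMeasure T (v i)) =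
      ∑ i, (-c i).toNNReal • spectralMeasure T (v i) := by
    refine Measure.ext_of_integral_eq_on_compactlySupported fun f => ?_
    have hf : ∀ i, Integrable f (spectralMeasure T (v i)) := fun i =>
      f.continuous.integrable_of_hasCompactSupport f.hasCompactSupport
    rw [key _ _ hf, key _ _ hf, ← sub_eq_zero, ← hsplit]
    simp_rw [integral_spectralMeasure]
    exact h _
  have hi := fun i => integrable_spectralMeasure T hη hC (v i)
  rw [hsplit]
  unfold spectralForm
  rw [← key _ _ hi, ← key _ _ hi, hμ, sub_self]

/-- The real bilinear form obtained from the spectral form by polarisation. -/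
def polarForm (T : H →L[ℂ] H) (η : ℝ → ℝ) (x y : H) : ℝ :=
  (spectralForm T η (x + y) - spectralForm T η (x - y)) / 4

theorem polarForm_add_right (T : H →L[ℂ] H) {η : ℝ → ℝ} (hη : Measurable η) {C : ℝ}
    (hC : ∀ t, |η t| ≤ C) (x y z : H) :
    polarForm T η x (y + z) = polarForm T η x y + polarForm T η x z := by
  have h := spectralForm_relation T hη hC ![1, -1, -1, 1, -1, 1]
    ![x + (y + z), x - (y + z), x + y, x - y, x + z, x - z] (fun A => by
      simp [Fin.sum_univ_succ, inner_add_left, inner_add_right, inner_sub_left, inner_sub_right]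
      ring)
  simp [Fin.sum_univ_succ] at h
  unfold polarForm
  linarith

theorem polarForm_smul_right (T : H →L[ℂ] H) {η : ℝ → ℝ} (hη : Measurable η) {C : ℝ}
    (hC : ∀ t, |η t| ≤ C) (x y : H) (r : ℝ) :
    polarForm T η x ((r : ℂ) • y) = r * polarForm T η x y := by
  have h := spectralForm_relation T hη hC ![1, -1, -r, r]
    ![x + (r : ℂ) • y, x - (r : ℂ) • y, x + y, x - y] (fun A => by
      simp [Fin.sum_univ_succ, inner_add_left, inner_add_right, inner_sub_left, inner_sub_right,
        inner_smul_left, inner_smul_right]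
      ring)
  simp [Fin.sum_univ_succ] at h
  unfold polarForm
  simp only [Complex.coe_smul]
  linarith

theorem polarForm_comm (T : H →L[ℂ] H) {η : ℝ → ℝ} (hη : Measurable η) {C : ℝ}
    (hC : ∀ t, |η t| ≤ C) (x y : H) : polarForm T η x y = polarForm T η y x := by
  have h := spectralForm_relation T hη hC ![1, -1, -1, 1]
    ![x + y, x - y, y + x, y - x] (fun A => by
      simp [Fin.sum_univ_succ, inner_add_left, inner_add_right, inner_sub_left, inner_sub_right]
      ring)
  simp [Fin.sum_univ_succ] at h
  unfold polarForm
  linarith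

theorem polarForm_I (T : H →L[ℂ] H) {η : ℝ → ℝ} (hη : Measurable η) {C : ℝ}
    (hC : ∀ t, |η t| ≤ C) (x y : H) :
    polarForm T η (Complex.I • x) y = - polarForm T η x (Complex.I • y) := by
  have h := spectralForm_relation T hη hC ![1, -1, 1, -1]
    ![Complex.I • x + y, Complex.I • x - y, x + Complex.I • y, x - Complex.I • y] (fun A => by
      simp [Fin.sum_univ_succ, inner_add_left, inner_add_right, inner_sub_left, inner_sub_right,
        inner_smul_left, inner_smul_right]
      ring)
  simp [Fin.sum_univ_succ] at h
  unfold polarForm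
  linarith

theorem polarForm_self (T : H →L[ℂ] H) {η : ℝ → ℝ} (hη : Measurable η) {C : ℝ}
    (hC : ∀ t, |η t| ≤ C) (x : H) : polarForm T η x x = spectralForm T η x := by
  have h := spectralForm_relation T hη hC ![1, -1, -4]
    ![x + x, x - x, x] (fun A => by
      simp [Fin.sum_univ_succ, inner_add_left, inner_add_right]
      ring)
  simp [Fin.sum_univ_succ] at h
  unfold polarForm
  simp
  linarith

theorem polarForm_self_I (T : H →L[ℂ] H) {η : ℝ → ℝ} (hη : Measurable η) {C : ℝ}
    (hC : ∀ t, |η t| ≤ C) (x : H) : polarForm T η x (Complex.I • x) = 0 := by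
  have h1 := polarForm_I T hη hC x x
  have h2 := polarForm_comm T hη hC (Complex.I • x) x
  linarith

theorem abs_polarForm_le (T : H →L[ℂ] H) {η : ℝ → ℝ} (hη : Measurable η) {C : ℝ}
    (hC : ∀ t, |η t| ≤ C) (x y : H) : |polarForm T η x y| ≤ C * (‖x‖ * ‖y‖) := by
  have hC0 : 0 ≤ C := (abs_nonneg _).trans (hC 0)
  have h1 : ∀ x y : H, |polarForm T η x y| ≤ C * ((‖x‖ ^ 2 + ‖y‖ ^ 2) / 2) := by
    intro x y
    have e1 := abs_le.1 (abs_spectralForm_le T hC (x + y))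
    have e2 := abs_le.1 (abs_spectralForm_le T hC (x - y))
    have e3 : ‖x + y‖ ^ 2 + ‖x - y‖ ^ 2 = 2 * (‖x‖ ^ 2 + ‖y‖ ^ 2) := by
      have := parallelogram_law_with_norm ℂ x y
      nlinarith
    have e4 : C * ‖x + y‖ ^ 2 + C * ‖x - y‖ ^ 2 = 2 * (C * (‖x‖ ^ 2 + ‖y‖ ^ 2)) := by
      rw [← mul_add, e3]; ring
    unfold polarForm
    rw [abs_le]
    constructor <;> linarith [e1.1, e1.2, e2.1, e2.2]
  have hl : ∀ (r : ℝ) (x y : H), polarForm T η ((r : ℂ) • x) y = r * polarForm T η x y := by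
    intro r x y
    rw [polarForm_comm T hη hC, polarForm_smul_right T hη hC, polarForm_comm T hη hC]
  have hz : ∀ x : H, polarForm T η x 0 = 0 := fun x => by simp [polarForm]
  by_cases hx : x = 0
  · rw [hx, polarForm_comm T hη hC, hz]; simp
  by_cases hy : y = 0
  · rw [hy, hz]; simp
  have hx' : 0 < ‖x‖ := norm_pos_iff.2 hx
  have hy' : 0 < ‖y‖ := norm_pos_iff.2 hy
  have h2 := h1 (((‖y‖ : ℝ) : ℂ) • x) (((‖x‖ : ℝ) : ℂ) • y)
  rw [hl, polarForm_smul_right T hη hC, norm_smul, norm_smul, Complex.norm_real, Complex.norm_real,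
    norm_norm, norm_norm, ← mul_assoc, abs_mul, abs_of_pos (mul_pos hy' hx')] at h2
  have h3 : ‖y‖ * ‖x‖ * |polarForm T η x y| ≤ ‖y‖ * ‖x‖ * (C * (‖x‖ * ‖y‖)) := by
    refine h2.trans (le_of_eq ?_)
    ring
  exact le_of_mul_le_mul_left h3 (mul_pos hy' hx')

/-- Existence of the Borel functional calculus. -/
theorem exists_borelCalculus (T : H →L[ℂ] H) {η : ℝ → ℝ} (hη : Measurable η) {C : ℝ}
    (hC : ∀ t, |η t| ≤ C) :
    ∃ M : H →L[ℂ] H, ∀ x : H, ⟪x, M x⟫_ℂ = ((∫ t, η t ∂(spectralMeasure T x) : ℝ) : ℂ) := by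
  have hC0 : 0 ≤ C := (abs_nonneg _).trans (hC 0)
  have addR := polarForm_add_right T hη hC
  have smulR := polarForm_smul_right T hη hC
  have comm := polarForm_comm T hη hC
  have mulI := polarForm_I T hη hC
  have addL : ∀ x y z : H, polarForm T η (x + y) z = polarForm T η x z + polarForm T η y z := by
    intro x y z
    rw [comm, addR, comm z x, comm z y]
  have smulL : ∀ (x y : H) (r : ℝ),
      polarForm T η ((r : ℂ) • x) y = r * polarForm T η x y := by
    intro x y r
    rw [comm, smulR, comm]
  have negR : ∀ x y : H, polarForm T η x (-y) = - polarForm T η x y := fun x y => by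
    have := smulR x y (-1)
    simpa using this
  have II : ∀ y : H, Complex.I • Complex.I • y = -y := fun y => by
    rw [smul_smul, Complex.I_mul_I, neg_one_smul]
  have dec : ∀ (c : ℂ) (y : H), c • y = (c.re : ℂ) • y + (c.im : ℂ) • Complex.I • y := by
    intro c y
    rw [smul_smul, ← add_smul, Complex.re_add_im]
  let b : H → H → ℂ := fun x y =>
    (polarForm T η x y : ℂ) - Complex.I * (polarForm T η x (Complex.I • y) : ℂ)
  have badd : ∀ x y z, b x (y + z) = b x y + b x z := by
    intro x y z
    simp only [b, smul_add, addR]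
    push_cast
    ring
  have badd' : ∀ x y z, b (x + y) z = b x z + b y z := by
    intro x y z
    simp only [b, addL]
    push_cast
    ring
  have bsmul : ∀ (c : ℂ) (x y : H), b x (c • y) = c * b x y := by
    intro c x y
    have e1 : polarForm T η x (c • y) =
        c.re * polarForm T η x y + c.im * polarForm T η x (Complex.I • y) := by
      rw [dec c y, addR, smulR, smulR]
    have e2 : polarForm T η x (Complex.I • c • y) =
        c.re * polarForm T η x (Complex.I • y) - c.im * polarForm T η x y := by
      rw [smul_comm, dec c (Complex.I • y), addR, smulR, smulR, II, negR]
      ring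
    simp only [b, e1, e2]
    apply Complex.ext <;> simp <;> ring
  have bsmul' : ∀ (c : ℂ) (x y : H), b (c • x) y = (starRingEnd ℂ) c * b x y := by
    intro c x y
    have e1 : ∀ y, polarForm T η (c • x) y =
        c.re * polarForm T η x y - c.im * polarForm T η x (Complex.I • y) := by
      intro y
      rw [dec c x, addL, smulL, smulL, mulI]
      ring
    simp only [b, e1, II, negR]
    apply Complex.ext <;> simp <;> ring
  have bbound : ∀ x y, ‖b x y‖ ≤ (2 * C) * ‖x‖ * ‖y‖ := by
    intro x y
    have e1 := abs_polarForm_le T hη hC x y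
    have e2 := abs_polarForm_le T hη hC x (Complex.I • y)
    rw [norm_smul, Complex.norm_I, one_mul] at e2
    refine (norm_sub_le _ _).trans ?_
    rw [norm_mul, Complex.norm_I, one_mul, Complex.norm_real, Complex.norm_real, Real.norm_eq_abs,
      Real.norm_eq_abs]
    linarith
  let B : H →L⋆[ℂ] H →L[ℂ] ℂ := LinearMap.mkContinuous₂
    (LinearMap.mk₂'ₛₗ (starRingEnd ℂ) (RingHom.id ℂ) b badd' bsmul' badd bsmul) (2 * C) bbound
  refine ⟨InnerProductSpace.continuousLinearMapOfBilin B, fun x => ?_⟩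
  have h1 : ⟪InnerProductSpace.continuousLinearMapOfBilin B x, x⟫_ℂ = b x x :=
    InnerProductSpace.continuousLinearMapOfBilin_apply B x x
  have h2 : b x x = ((∫ t, η t ∂(spectralMeasure T x) : ℝ) : ℂ) := by
    simp only [b, polarForm_self T hη hC, polarForm_self_I T hη hC]
    simp [spectralForm]
  rw [← inner_conj_symm, h1, h2, Complex.conj_ofReal]

open Classical in
/-- The Borel functional calculus: for a bounded self-adjoint `T` and a bounded Borel function `η`,
`η(T)` is the bounded operator `M` with `⟨x, M x⟩ = ∫ η dμ_x` for all `x`, where `μ_x` is the spectral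
measure of `T` at `x`. It exists by `exists_borelCalculus`. -/
def borelCalculus (T : H →L[ℂ] H) (η : ℝ → ℝ) : H →L[ℂ] H :=
  if h : ∃ M : H →L[ℂ] H, ∀ x : H,
      ⟪x, M x⟫_ℂ = ((∫ t, η t ∂(spectralMeasure T x) : ℝ) : ℂ)
  then h.choose else 0

theorem inner_borelCalculus (T : H →L[ℂ] H) {η : ℝ → ℝ} (hη : Measurable η) {C : ℝ}
    (hC : ∀ t, |η t| ≤ C) (x : H) :
    ⟪x, borelCalculus T η x⟫_ℂ = ((∫ t, η t ∂(spectralMeasure T x) : ℝ) : ℂ) := by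
  have h := exists_borelCalculus T hη hC
  unfold borelCalculus
  rw [dif_pos h]
  exact h.choose_spec x

end BorelCalculus

/-! ### The adelic Dirac operators -/

/-- The chiral operator `D_∞` at the real place, with off-diagonal entries `Q_∞`. -/
def dInf (U : ℝ → ℝ) (Estar : ℝ) : Double L2R →ₗ.[ℂ] Double L2R := chiral (qInf U Estar)

/-- The background operator `D_glob = D_∞ ⊗ I_fin` in `L²(X) ⊕ L²(X)`, for an identification `W` of
`L²(X)` with the tensor product of `L²(ℝ)` and the finite factor `K`. -/
def dGlob {K : Type*} [NormedAddCommGroup K] [InnerProductSpace ℂ K]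
    (W : L2X ≃ₗᵢ[ℂ] HilbertTensor L2R K) (U : ℝ → ℝ) (Estar : ℝ) :
    Double L2X →ₗ.[ℂ] Double L2X :=
  tensorId W (dInf U Estar)

/-- The inclusion of the doubled physical space in `L²(X) ⊕ L²(X)`. -/
def physIncl (Φ₀ : L2X) : Double (HPhys Φ₀) →L[ℂ] Double L2X := diagCLM (HPhys Φ₀).subtypeL

/-- The orthogonal projection of `L²(X) ⊕ L²(X)` onto the doubled physical space. -/
def physProj (Φ₀ : L2X) : Double L2X →L[ℂ] Double L2X := diagCLM (HPhys Φ₀).starProjection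

/-- The background operator `D_glob` in the doubled physical space. -/
def dGlobPhys {K : Type*} [NormedAddCommGroup K] [InnerProductSpace ℂ K]
    (W : L2X ≃ₗᵢ[ℂ] HilbertTensor L2R K) (U : ℝ → ℝ) (Estar : ℝ) (Φ₀ : L2X) :
    Double (HPhys Φ₀) →ₗ.[ℂ] Double (HPhys Φ₀) :=
  part (physIncl Φ₀) (dGlob W U Estar)

/-- The mass term at `p`, with zero diagonal and off-diagonal entries `M_p = η_p(T_p)`. -/
def massTerm {H : Type*} [NormedAddCommGroup H] [InnerProductSpace ℂ H] [CompleteSpace H]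
    (T : PrimeNumber → H →L[ℂ] H) (η : PrimeNumber → ℝ → ℝ) (p : PrimeNumber) :
    Double H →L[ℂ] Double H :=
  chiralCLM (borelCalculus (T p) (η p))

/-- The mass operator, the sum over all primes of the mass terms in the operator norm. -/
def massOperator {H : Type*} [NormedAddCommGroup H] [InnerProductSpace ℂ H] [CompleteSpace H]
    (T : PrimeNumber → H →L[ℂ] H) (η : PrimeNumber → ℝ → ℝ) : Double H →L[ℂ] Double H :=
  ∑' p, massTerm T η p

/-- The arithmetic Dirac operator `D_glob + 𝓜`, with domain `D(D_glob)`. -/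
def dArith {K : Type*} [NormedAddCommGroup K] [InnerProductSpace ℂ K]
    (W : L2X ≃ₗᵢ[ℂ] HilbertTensor L2R K) (U : ℝ → ℝ) (Estar : ℝ) (Φ₀ : L2X)
    (T : PrimeNumber → HPhys Φ₀ →L[ℂ] HPhys Φ₀) (η : PrimeNumber → ℝ → ℝ) :
    Double (HPhys Φ₀) →ₗ.[ℂ] Double (HPhys Φ₀) :=
  (massOperator T η : Double (HPhys Φ₀) →ₗ[ℂ] Double (HPhys Φ₀)) +ᵥ dGlobPhys W U Estar Φ₀

end AdelicDirac

end

/-!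
Self-adjointness is checked on graphs: an operator is self-adjoint iff its graph `G` is equal to the
adjoint linear relation `G*`, and a closed symmetric relation is so as soon as `G ± i` have dense
range. A vector orthogonal to the range of `-i d/dy ± i` on test functions is a weak `L²` solution
of `f' = c f` with `c` real and nonzero, hence zero: its mollifications are bounded classical
solutions. So `-i d/dy` is self-adjoint. The free operator `-d²/dy²` is its square, with
`G² + 1 = (G + i)(G - i)` onto, and `U - E` is a bounded symmetric perturbation. Passing to the
off-diagonal matrix keeps self-adjointness, and so does passing to the part in a reducing subspace.
For `D ⊗ I` the ranges of `D ⊗ I ± i` contain all `ψ ⊗ k`.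

Since `‖η_p(T_p)‖ ≤ sup |η_p|`, the mass series converges absolutely in norm and its sum is bounded
and self-adjoint, which gives the self-adjointness of the arithmetic operator. If all the terms are
compact, so is the sum. A compact operator is a small operator plus one of finite rank, and neither
destroys Fredholmness on the graph of a closed operator, so the essential spectrum is unchanged.
-/

noncomputable section

namespace AdelicDirac

/-! ### Self-adjoint linear relations -/

section Relations

variable {𝕜 E : Type*} [RCLike 𝕜] [NormedAddCommGroup E] [InnerProductSpace 𝕜 E]
  {G : Submodule 𝕜 (E × E)}

theorem mem_adjoint_iff_inner_eq {x : E × E} :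
    x ∈ G.adjoint ↔ ∀ p ∈ G, ⟪p.2, x.1⟫_𝕜 = ⟪p.1, x.2⟫_𝕜 := by
  simp only [Submodule.mem_adjoint_iff, sub_eq_zero, Prod.forall]

theorem inner_snd_fst_eq (hG : G ≤ G.adjoint) {p q : E × E} (hp : p ∈ G) (hq : q ∈ G) :
    ⟪p.2, q.1⟫_𝕜 = ⟪p.1, q.2⟫_𝕜 :=
  mem_adjoint_iff_inner_eq.1 (hG hq) p hp

theorem isClosed_adjoint (G : Submodule 𝕜 (E × E)) : IsClosed (G.adjoint : Set (E × E)) := by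
  have h : (G.adjoint : Set (E × E)) = ⋂ p ∈ G, {x | ⟪p.2, x.1⟫_𝕜 = ⟪p.1, x.2⟫_𝕜} := by
    ext x
    simp only [SetLike.mem_coe, mem_adjoint_iff_inner_eq, mem_iInter, mem_ofPred_eq]
  rw [h]
  exact isClosed_biInter fun p _ => isClosed_eq (by fun_prop) (by fun_prop)

theorem mem_adjoint_closure_span_iff {S : Set (E × E)} {x : E × E} :
    x ∈ (Submodule.span 𝕜 S).topologicalClosure.adjoint ↔
      ∀ p ∈ S, ⟪p.2, x.1⟫_𝕜 = ⟪p.1, x.2⟫_𝕜 := by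
  refine ⟨fun h p hp => mem_adjoint_iff_inner_eq.1 h p
    (Submodule.le_topologicalClosure _ (Submodule.subset_span hp)), fun h => ?_⟩
  have hS : S ⊆ (𝕜 ∙ x).adjoint := fun p hp => mem_adjoint_iff_inner_eq.2 fun q hq => by
    obtain ⟨a, rfl⟩ := Submodule.mem_span_singleton.1 hq
    rw [Prod.smul_snd, Prod.smul_fst, inner_smul_left, inner_smul_left, ← inner_conj_symm,
      ← h p hp, inner_conj_symm]
  have hle := Submodule.topologicalClosure_minimal _ (Submodule.span_le.2 hS) (isClosed_adjoint _)
  refine mem_adjoint_iff_inner_eq.2 fun p hp => ?_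
  have hx := mem_adjoint_iff_inner_eq.1 (hle hp) x (Submodule.mem_span_singleton_self x)
  rw [← inner_conj_symm, ← hx, inner_conj_symm]

theorem closure_span_le_adjoint {S : Set (E × E)}
    (hS : ∀ p ∈ S, ∀ q ∈ S, ⟪p.2, q.1⟫_𝕜 = ⟪p.1, q.2⟫_𝕜) :
    (Submodule.span 𝕜 S).topologicalClosure ≤ (Submodule.span 𝕜 S).topologicalClosure.adjoint :=
  Submodule.topologicalClosure_minimal _
    (Submodule.span_le.2 fun q hq => mem_adjoint_closure_span_iff.2 fun p hp => hS p hp q hq)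
    (isClosed_adjoint _)

theorem isSelfAdjoint_iff_adjoint_graph_eq [CompleteSpace E] {A : E →ₗ.[𝕜] E} :
    IsSelfAdjoint A ↔ A.graph.adjoint = A.graph := by
  refine ⟨fun h => ?_, fun h => ?_⟩
  · rw [← LinearPMap.adjoint_graph_eq_graph_adjoint h.dense_domain,
      LinearPMap.isSelfAdjoint_def.1 h]
  -- A vector `v` orthogonal to the domain gives `(0, v) ∈ A.graph.adjoint`, so the domain is dense.
  have hd : Dense (A.domain : Set E) := by
    rw [Submodule.dense_iff_topologicalClosure_eq_top, Submodule.topologicalClosure_eq_top_iff,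
      Submodule.eq_bot_iff]
    refine fun v hv => A.graph_fst_eq_zero_snd (x := 0) ?_ rfl
    rw [← h, mem_adjoint_iff_inner_eq]
    intro p hp
    rw [inner_zero_right, hv p.1 (LinearPMap.mem_domain_of_mem_graph (y := p.2) hp)]
  exact LinearPMap.isSelfAdjoint_def.2 <| LinearPMap.eq_of_eq_graph <|
    (LinearPMap.adjoint_graph_eq_graph_adjoint hd).trans h

/-- The range of `G + c` for a linear relation `G` and a scalar `c`. -/
def rangeAdd (G : Submodule 𝕜 (E × E)) (c : 𝕜) : Submodule 𝕜 E :=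
  G.map (LinearMap.snd 𝕜 E E + c • LinearMap.fst 𝕜 E E)

theorem mem_rangeAdd {c : 𝕜} {z : E} : z ∈ rangeAdd G c ↔ ∃ p ∈ G, p.2 + c • p.1 = z :=
  Iff.rfl

theorem mem_orthogonal_rangeAdd {c : 𝕜} {v : E} :
    v ∈ (rangeAdd G c)ᗮ ↔ (v, -(starRingEnd 𝕜) c • v) ∈ G.adjoint := by
  simp only [Submodule.mem_orthogonal, mem_rangeAdd, forall_exists_index, and_imp,
    forall_apply_eq_imp_iff₂, mem_adjoint_iff_inner_eq, inner_add_left, inner_smul_left,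
    inner_smul_right, neg_mul, eq_neg_iff_add_eq_zero]

theorem adjoint_eq_of_rangeAdd_eq_top (hG : G ≤ G.adjoint) {c : 𝕜} (h : rangeAdd G c = ⊤)
    (h' : rangeAdd G ((starRingEnd 𝕜) c) = ⊤) : G.adjoint = G := by
  refine le_antisymm (fun x hx => ?_) hG
  obtain ⟨q, hq, hqx⟩ := mem_rangeAdd.1 (h ▸ Submodule.mem_top : x.2 + c • x.1 ∈ rangeAdd G c)
  have hsnd : x.2 - q.2 = -c • (x.1 - q.1) := by
    rw [neg_smul, smul_sub, neg_sub, sub_eq_sub_iff_add_eq_add, ← hqx, add_comm]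
  have hfst : x.1 - q.1 = 0 := by
    rw [← Submodule.mem_bot 𝕜, ← Submodule.top_orthogonal_eq_bot, ← h', mem_orthogonal_rangeAdd,
      RCLike.conj_conj, ← hsnd]
    exact sub_mem hx (hG hq)
  rw [hfst, smul_zero] at hsnd
  rwa [Prod.ext (sub_eq_zero.1 hfst) (sub_eq_zero.1 hsnd)]

/-- The square of a linear relation `G`: the pairs `(x, z)` with `(x, y) ∈ G` and `(y, z) ∈ G` for
some `y`. -/
def sqRel (G : Submodule 𝕜 (E × E)) : Submodule 𝕜 (E × E) where
  carrier := {p | ∃ y, (p.1, y) ∈ G ∧ (y, p.2) ∈ G}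
  zero_mem' := ⟨0, G.zero_mem, G.zero_mem⟩
  add_mem' := fun ⟨y, h₁, h₂⟩ ⟨y', h₁', h₂'⟩ => ⟨y + y', G.add_mem h₁ h₁', G.add_mem h₂ h₂'⟩
  smul_mem' := fun a _ ⟨y, h₁, h₂⟩ => ⟨a • y, G.smul_mem a h₁, G.smul_mem a h₂⟩

theorem sqRel_le_adjoint (hG : G ≤ G.adjoint) : sqRel G ≤ (sqRel G).adjoint := by
  rintro q ⟨y, hqy, hyq⟩
  refine mem_adjoint_iff_inner_eq.2 ?_
  rintro p ⟨x, hpx, hxp⟩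
  exact (inner_snd_fst_eq hG hxp hqy).trans (inner_snd_fst_eq hG hpx hyq)

end Relations

section ComplexRelations

variable {E : Type*} [NormedAddCommGroup E] [InnerProductSpace ℂ E]
  {G : Submodule ℂ (E × E)} {c : ℂ}

theorem norm_snd_add_smul_fst_sq (hG : G ≤ G.adjoint) (hc : c.re = 0) {p : E × E} (hp : p ∈ G) :
    ‖p.2 + c • p.1‖ ^ 2 = ‖p.2‖ ^ 2 + ‖c‖ ^ 2 * ‖p.1‖ ^ 2 := by
  have him : (⟪p.2, p.1⟫_ℂ).im = 0 := by
    rw [← Complex.conj_eq_iff_im, inner_conj_symm, inner_snd_fst_eq hG hp hp]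
  have hre : RCLike.re ⟪p.2, c • p.1⟫_ℂ = 0 := by
    simp [him, hc]
  rw [norm_add_sq (𝕜 := ℂ), hre, norm_smul]
  ring

theorem eq_zero_of_mem_smul (hG : G ≤ G.adjoint) (hc : c.re = 0) (hc0 : c ≠ 0) {v : E}
    (hv : (v, c • v) ∈ G) : v = 0 := by
  have h := norm_snd_add_smul_fst_sq (c := -c) hG (by simp [hc]) hv
  rw [neg_smul, add_neg_cancel, norm_zero, norm_smul, norm_neg] at h
  have hcv : ‖c‖ * ‖v‖ = 0 := by nlinarith [sq_nonneg (‖c‖ * ‖v‖)]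
  exact norm_eq_zero.1 ((mul_eq_zero.1 hcv).resolve_left (norm_ne_zero_iff.2 hc0))

variable [CompleteSpace E]

theorem isClosed_rangeAdd (hGc : IsClosed (G : Set (E × E))) (hG : G ≤ G.adjoint)
    (hc : c.re = 0) (hc0 : c ≠ 0) : IsClosed (rangeAdd G c : Set E) := by
  have : CompleteSpace G := hGc.completeSpace_coe
  let L : G →L[ℂ] E :=
    (ContinuousLinearMap.snd ℂ E E + c • ContinuousLinearMap.fst ℂ E E) ∘L G.subtypeL
  have hc' : 0 < ‖c‖ := norm_pos_iff.2 hc0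
  have hL : AntilipschitzWith (max 1 ‖c‖₊⁻¹) L := L.antilipschitz_of_bound fun p => by
    have h : ‖L p‖ ^ 2 = ‖p.1.2‖ ^ 2 + ‖c‖ ^ 2 * ‖p.1.1‖ ^ 2 := norm_snd_add_smul_fst_sq hG hc p.2
    have hfst : ‖p.1.1‖ ≤ ‖c‖⁻¹ * ‖L p‖ := by
      rw [inv_mul_eq_div, le_div_iff₀ hc']
      exact le_of_sq_le_sq (by nlinarith [sq_nonneg ‖p.1.2‖]) (norm_nonneg _)
    have hsnd : ‖p.1.2‖ ≤ 1 * ‖L p‖ := by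
      rw [one_mul]
      exact le_of_sq_le_sq (by nlinarith [sq_nonneg (‖c‖ * ‖p.1.1‖)]) (norm_nonneg _)
    rw [NNReal.coe_max, max_mul_of_nonneg _ _ (norm_nonneg _)]
    exact max_le (hfst.trans (le_max_right _ _)) (hsnd.trans (le_max_left _ _))
  have hrange : (rangeAdd G c : Set E) = Set.range L := by
    ext z
    exact ⟨fun ⟨p, hp, h⟩ => ⟨⟨p, hp⟩, h⟩, fun ⟨p, h⟩ => ⟨p.1, p.2, h⟩⟩
  rw [hrange]
  exact hL.isClosed_range L.uniformContinuous

theorem rangeAdd_eq_top_of_orthogonal_eq_bot (hGc : IsClosed (G : Set (E × E)))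
    (hG : G ≤ G.adjoint) (hc : c.re = 0) (hc0 : c ≠ 0) (h : (rangeAdd G c)ᗮ = ⊥) :
    rangeAdd G c = ⊤ := by
  rw [← (isClosed_rangeAdd hGc hG hc hc0).submodule_topologicalClosure_eq,
    Submodule.topologicalClosure_eq_top_iff, h]

theorem rangeAdd_eq_top (hG : G.adjoint = G) (hc : c.re = 0) (hc0 : c ≠ 0) :
    rangeAdd G c = ⊤ := by
  refine rangeAdd_eq_top_of_orthogonal_eq_bot (hG ▸ isClosed_adjoint G) hG.ge hc hc0 ?_
  refine (Submodule.eq_bot_iff _).2 fun v hv => ?_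
  rw [mem_orthogonal_rangeAdd, hG] at hv
  exact eq_zero_of_mem_smul hG.ge (by simp [hc]) (by simpa using hc0) hv

theorem adjoint_eq_of_orthogonal_rangeAdd_eq_bot (hGc : IsClosed (G : Set (E × E)))
    (hG : G ≤ G.adjoint) (h : (rangeAdd G Complex.I)ᗮ = ⊥) (h' : (rangeAdd G (-Complex.I))ᗮ = ⊥) :
    G.adjoint = G := by
  refine adjoint_eq_of_rangeAdd_eq_top hG
    (rangeAdd_eq_top_of_orthogonal_eq_bot hGc hG Complex.I_re Complex.I_ne_zero h) ?_
  rw [Complex.conj_I]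
  exact rangeAdd_eq_top_of_orthogonal_eq_bot hGc hG (by simp) (by simp) h'

/-- The range of `G² + 1 = (G + i)(G - i)` is everything because those of `G ± i` are. -/
theorem adjoint_sqRel_eq (hG : G.adjoint = G) : (sqRel G).adjoint = sqRel G := by
  have htop : rangeAdd (sqRel G) (1 : ℂ) = ⊤ := by
    refine Submodule.eq_top_iff'.2 fun z => ?_
    obtain ⟨p, hp, hpz⟩ := mem_rangeAdd.1
      (rangeAdd_eq_top hG Complex.I_re Complex.I_ne_zero ▸ Submodule.mem_top (x := z))
    obtain ⟨q, hq, hqp⟩ := mem_rangeAdd.1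
      (rangeAdd_eq_top hG (c := -Complex.I) (by simp) (by simp) ▸ Submodule.mem_top (x := p.1))
    have hq' : (q.2, p.2 + Complex.I • q.2) ∈ G := by
      have hpq : p + Complex.I • q = (q.2, p.2 + Complex.I • q.2) :=
        Prod.ext (by simp [← hqp]) rfl
      exact hpq ▸ add_mem hp (G.smul_mem Complex.I hq)
    refine ⟨(q.1, p.2 + Complex.I • q.2), ⟨q.2, hq, hq'⟩, ?_⟩
    change p.2 + Complex.I • q.2 + (1 : ℂ) • q.1 = z
    rw [← hpz, ← hqp, smul_add, smul_smul]
    simp [add_assoc]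
  exact adjoint_eq_of_rangeAdd_eq_top (sqRel_le_adjoint hG.ge) htop (by rwa [map_one])

end ComplexRelations

/-! ### Perturbations, operator matrices, parts and tensor products -/

section BoundedPerturbation

theorem mem_graph_vadd {R E F : Type*} [Ring R] [AddCommGroup E] [Module R E] [AddCommGroup F]
    [Module R F] {B : E →ₗ[R] F} {A : E →ₗ.[R] F} {p : E × F} :
    p ∈ (B +ᵥ A).graph ↔ (p.1, p.2 - B p.1) ∈ A.graph := by
  simp only [LinearPMap.mem_graph_iff, LinearPMap.vadd_apply, LinearPMap.vadd_domain]
  refine exists_congr fun y => and_congr_right fun hy => ?_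
  rw [hy, eq_sub_iff_add_eq']

theorem isSelfAdjoint_vadd {𝕜 E : Type*} [RCLike 𝕜] [NormedAddCommGroup E] [InnerProductSpace 𝕜 E]
    [CompleteSpace E] {A : E →ₗ.[𝕜] E} (hA : IsSelfAdjoint A) {B : E →ₗ[𝕜] E}
    (hB : B.IsSymmetric) : IsSelfAdjoint (B +ᵥ A) := by
  rw [isSelfAdjoint_iff_adjoint_graph_eq] at hA ⊢
  ext x
  rw [mem_graph_vadd, ← hA, mem_adjoint_iff_inner_eq, mem_adjoint_iff_inner_eq]
  refine ⟨fun h p hp => ?_, fun h p hp => ?_⟩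
  · have hx := h (p.1, p.2 + B p.1) (mem_graph_vadd.2 (by simpa using hp))
    rw [inner_add_left, hB] at hx
    rw [inner_sub_right, ← hx, add_sub_cancel_right]
  · have hx := h _ (mem_graph_vadd.1 hp)
    rwa [inner_sub_left, inner_sub_right, hB, sub_left_inj] at hx

end BoundedPerturbation

section Doubles

variable {E F : Type*} [NormedAddCommGroup E] [InnerProductSpace ℂ E]
  [NormedAddCommGroup F] [InnerProductSpace ℂ F]

theorem inner_double (x y : Double E) : ⟪x, y⟫_ℂ = ⟪x.fst, y.fst⟫_ℂ + ⟪x.snd, y.snd⟫_ℂ := rfl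

theorem mem_graph_chiral {A : E →ₗ.[ℂ] E} {p : Double E × Double E} :
    p ∈ (chiral A).graph ↔ (p.1.fst, p.2.snd) ∈ A.graph ∧ (p.1.snd, p.2.fst) ∈ A.graph := by
  simp only [LinearPMap.mem_graph_iff]
  constructor
  · rintro ⟨y, hy, hAy⟩
    rw [← hy, ← hAy]
    exact ⟨⟨⟨y.1.fst, y.2.1⟩, rfl, rfl⟩, ⟨⟨y.1.snd, y.2.2⟩, rfl, rfl⟩⟩
  · rintro ⟨⟨y, hy, hAy⟩, ⟨z, hz, hAz⟩⟩
    obtain ⟨⟨a, b⟩, ⟨c, d⟩⟩ := p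
    obtain ⟨rfl, rfl, rfl, rfl⟩ : y.1 = a ∧ A y = d ∧ z.1 = b ∧ A z = c := ⟨hy, hAy, hz, hAz⟩
    exact ⟨⟨WithLp.toLp 2 (y.1, z.1), y.2, z.2⟩, rfl, rfl⟩

theorem isSelfAdjoint_chiral [CompleteSpace E] {A : E →ₗ.[ℂ] E} (hA : IsSelfAdjoint A) :
    IsSelfAdjoint (chiral A) := by
  rw [isSelfAdjoint_iff_adjoint_graph_eq] at hA ⊢
  ext x
  rw [mem_graph_chiral, ← hA]
  simp only [mem_adjoint_iff_inner_eq, inner_double]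
  refine ⟨fun h => ⟨fun p hp => ?_, fun p hp => ?_⟩, fun ⟨hfst, hsnd⟩ p hp => ?_⟩
  · simpa using h (WithLp.toLp 2 (0, p.1), WithLp.toLp 2 (p.2, 0))
      (mem_graph_chiral.2 ⟨A.graph.zero_mem, hp⟩)
  · simpa using h (WithLp.toLp 2 (p.1, 0), WithLp.toLp 2 (0, p.2))
      (mem_graph_chiral.2 ⟨hp, A.graph.zero_mem⟩)
  · obtain ⟨hp, hp'⟩ := mem_graph_chiral.1 hp
    rw [hfst _ hp', hsnd _ hp, add_comm]

theorem adjoint_diagCLM [CompleteSpace E] [CompleteSpace F] (M : E →L[ℂ] F) :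
    (diagCLM M).adjoint = diagCLM M.adjoint := by
  refine ((ContinuousLinearMap.eq_adjoint_iff _ _).2 fun x y => ?_).symm
  exact congrArg₂ (· + ·) (M.adjoint_inner_left _ _) (M.adjoint_inner_left _ _)

end Doubles

section Part

variable {E F : Type*} [NormedAddCommGroup E] [InnerProductSpace ℂ E]
  [NormedAddCommGroup F] [InnerProductSpace ℂ F] {J : F →L[ℂ] E}

theorem mem_graph_part (hJ : Function.Injective J) {D : E →ₗ.[ℂ] E} {p : F × F} :
    p ∈ (part J D).graph ↔ (J p.1, J p.2) ∈ D.graph := by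
  have hgraph : (part J D).graph = D.graph.comap (J.prodMap J).toLinearMap := by
    refine Submodule.toLinearPMap_graph_eq _ fun x hx h0 => hJ ?_
    rw [map_zero]
    exact D.graph_fst_eq_zero_snd (x := J x.1) hx (by rw [h0, map_zero])
  rw [hgraph]
  rfl

theorem mem_graph_of_isReducedBy {P : E →L[ℂ] E} {D : E →ₗ.[ℂ] E} (h : IsReducedBy P D) {p : E × E}
    (hp : p ∈ D.graph) : (P p.1, P p.2) ∈ D.graph := by
  obtain ⟨y, hy, hDy⟩ := (LinearPMap.mem_graph_iff _).1 hp
  obtain ⟨hPy, hDPy⟩ := h y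
  rw [← hy, ← hDy, ← hDPy]
  exact D.mem_graph ⟨P y, hPy⟩

open ContinuousLinearMap in
theorem isSelfAdjoint_part [CompleteSpace E] [CompleteSpace F] {D : E →ₗ.[ℂ] E}
    (hD : IsSelfAdjoint D) (hJ : J.adjoint ∘L J = 1) (hred : IsReducedBy (J ∘L J.adjoint) D) :
    IsSelfAdjoint (part J D) := by
  have hleft : ∀ x, J.adjoint (J x) = x := fun x => DFunLike.congr_fun hJ x
  have hinj : Function.Injective J := Function.LeftInverse.injective hleft
  rw [isSelfAdjoint_iff_adjoint_graph_eq] at hD ⊢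
  ext x
  rw [mem_graph_part hinj, ← hD, mem_adjoint_iff_inner_eq, mem_adjoint_iff_inner_eq]
  refine ⟨fun h p hp => ?_, fun h p hp => ?_⟩
  · have hJp : (J.adjoint p.1, J.adjoint p.2) ∈ (part J D).graph :=
      (mem_graph_part hinj).2 (mem_graph_of_isReducedBy hred hp)
    rw [← adjoint_inner_left, ← adjoint_inner_left]
    exact h _ hJp
  · have hx := h _ ((mem_graph_part hinj).1 hp)
    rwa [← adjoint_inner_left, ← adjoint_inner_left, hleft, hleft] at hx

end Part

section TensorId

variable {E K H : Type*} [NormedAddCommGroup E] [InnerProductSpace ℂ E]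
  [NormedAddCommGroup K] [InnerProductSpace ℂ K] [NormedAddCommGroup H] [InnerProductSpace ℂ H]

theorem inner_pureTensor (W : H ≃ₗᵢ[ℂ] HilbertTensor E K) (ψ φ : Double E) (k l : K) :
    ⟪pureTensor W ψ k, pureTensor W φ l⟫_ℂ = ⟪ψ, φ⟫_ℂ * ⟪k, l⟫_ℂ := by
  simp [pureTensor, UniformSpace.Completion.inner_coe, add_mul]

theorem pureTensor_add_smul (W : H ≃ₗᵢ[ℂ] HilbertTensor E K) (ψ φ : Double E) (c : ℂ) (k : K) :
    pureTensor W (ψ + c • φ) k = pureTensor W ψ k + c • pureTensor W φ k := by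
  refine WithLp.ofLp_injective 2 (Prod.ext ?_ ?_) <;>
  simp [pureTensor, TensorProduct.add_tmul, UniformSpace.Completion.coe_add,
    ← TensorProduct.smul_tmul', UniformSpace.Completion.coe_smul]

theorem continuous_pureTensor_left (W : H ≃ₗᵢ[ℂ] HilbertTensor E K) (k : K) :
    Continuous fun ψ => pureTensor W ψ k := by
  have htmul : Continuous fun x : E => x ⊗ₜ[ℂ] k :=
    (((TensorProduct.mk ℂ E K).flip k).mkContinuous ‖k‖ fun x => by simp [mul_comm]).continuous
  have hW : Continuous fun x : E => W.symm ((x ⊗ₜ[ℂ] k : E ⊗[ℂ] K) : HilbertTensor E K) :=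
    W.symm.continuous.comp ((UniformSpace.Completion.continuous_coe _).comp htmul)
  exact (WithLp.prod_continuous_toLp _ _ _).comp
    ((hW.comp (WithLp.fstL 2 ℂ E E).continuous).prodMk (hW.comp (WithLp.sndL 2 ℂ E E).continuous))

theorem eq_zero_of_inner_tmul {v : HilbertTensor E K}
    (h : ∀ (x : E) (k : K), ⟪((x ⊗ₜ[ℂ] k : E ⊗[ℂ] K) : HilbertTensor E K), v⟫_ℂ = 0) : v = 0 := by
  have halg : ∀ w : E ⊗[ℂ] K, ⟪(w : HilbertTensor E K), v⟫_ℂ = 0 := fun w => by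
    induction w with
    | zero => rw [UniformSpace.Completion.coe_zero, inner_zero_left]
    | tmul x k => exact h x k
    | add a b ha hb => rw [UniformSpace.Completion.coe_add, inner_add_left, ha, hb, add_zero]
  exact UniformSpace.Completion.denseRange_coe.eq_zero_of_inner_right ℂ halg

theorem eq_zero_of_inner_pureTensor (W : H ≃ₗᵢ[ℂ] HilbertTensor E K) {v : Double H}
    (h : ∀ (ψ : Double E) (k : K), ⟪pureTensor W ψ k, v⟫_ℂ = 0) : v = 0 := by
  have hH : ∀ u : H, (∀ (x : E) (k : K), ⟪W.symm ↑(x ⊗ₜ[ℂ] k), u⟫_ℂ = 0) → u = 0 := fun u hu => by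
    refine W.map_eq_zero_iff.1 (eq_zero_of_inner_tmul fun x k => ?_)
    rw [← hu x k, ← W.inner_map_map, W.apply_symm_apply]
  refine WithLp.ofLp_injective 2 (Prod.ext (hH _ fun x k => ?_) (hH _ fun x k => ?_))
  · simpa [inner_double, pureTensor, UniformSpace.Completion.coe_zero] using
      h (WithLp.toLp 2 (x, 0)) k
  · simpa [inner_double, pureTensor, UniformSpace.Completion.coe_zero] using
      h (WithLp.toLp 2 (0, x)) k

/-- The graph of `D ⊗ I`: the closed span of the pairs `(ψ ⊗ k, D ψ ⊗ k)`. It is a linear relation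
from which `tensorId W D` is built without knowing that it is single-valued. -/
def tensorGraph (W : H ≃ₗᵢ[ℂ] HilbertTensor E K) (D : Double E →ₗ.[ℂ] Double E) :
    Submodule ℂ (Double H × Double H) :=
  (Submodule.span ℂ (Set.range fun q : D.domain × K =>
    (pureTensor W q.1 q.2, pureTensor W (D q.1) q.2))).topologicalClosure

variable {W : H ≃ₗᵢ[ℂ] HilbertTensor E K} {D : Double E →ₗ.[ℂ] Double E}

theorem pureTensor_mem_tensorGraph {p : Double E × Double E} (hp : p ∈ D.graph) (k : K) :
    (pureTensor W p.1 k, pureTensor W p.2 k) ∈ tensorGraph W D := by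
  obtain ⟨y, hy, hDy⟩ := (LinearPMap.mem_graph_iff _).1 hp
  refine Submodule.le_topologicalClosure _ (Submodule.subset_span ⟨(y, k), ?_⟩)
  simp only [hy, hDy]

theorem tensorGraph_le_adjoint (hD : D.graph ≤ D.graph.adjoint) :
    tensorGraph W D ≤ (tensorGraph W D).adjoint := by
  refine closure_span_le_adjoint ?_
  rintro _ ⟨⟨x, k⟩, rfl⟩ _ ⟨⟨y, l⟩, rfl⟩
  simp only [inner_pureTensor, inner_snd_fst_eq hD (D.mem_graph x) (D.mem_graph y)]

variable [CompleteSpace E]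

theorem graph_tensorId (hD : IsSelfAdjoint D) : (tensorId W D).graph = tensorGraph W D := by
  have hsymm := tensorGraph_le_adjoint (W := W) (isSelfAdjoint_iff_adjoint_graph_eq.1 hD).ge
  refine Submodule.toLinearPMap_graph_eq _ fun x hx h0 =>
    eq_zero_of_inner_pureTensor W fun ψ k => ?_
  refine hD.dense_domain.induction (fun ψ hψ => ?_)
    (isClosed_eq ((continuous_pureTensor_left W k).inner continuous_const) continuous_const) ψ
  rw [← inner_snd_fst_eq hsymm (pureTensor_mem_tensorGraph (D.mem_graph ⟨ψ, hψ⟩) k) hx, h0,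
    inner_zero_right]

theorem orthogonal_rangeAdd_tensorGraph (hD : IsSelfAdjoint D) {c : ℂ} (hc : c.re = 0)
    (hc0 : c ≠ 0) : (rangeAdd (tensorGraph W D) c)ᗮ = ⊥ := by
  rw [Submodule.eq_bot_iff]
  refine fun v hv => eq_zero_of_inner_pureTensor W fun ψ k => ?_
  obtain ⟨p, hp, rfl⟩ := mem_rangeAdd.1
    (rangeAdd_eq_top (isSelfAdjoint_iff_adjoint_graph_eq.1 hD) hc hc0 ▸ Submodule.mem_top (x := ψ))
  rw [pureTensor_add_smul]
  exact hv _ (mem_rangeAdd.2 ⟨_, pureTensor_mem_tensorGraph hp k, rfl⟩)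

theorem isSelfAdjoint_tensorId [CompleteSpace H] (hD : IsSelfAdjoint D) :
    IsSelfAdjoint (tensorId W D) := by
  rw [isSelfAdjoint_iff_adjoint_graph_eq, graph_tensorId hD]
  exact adjoint_eq_of_orthogonal_rangeAdd_eq_bot (Submodule.isClosed_topologicalClosure _)
    (tensorGraph_le_adjoint (isSelfAdjoint_iff_adjoint_graph_eq.1 hD).ge)
    (orthogonal_rangeAdd_tensorGraph hD Complex.I_re Complex.I_ne_zero)
    (orthogonal_rangeAdd_tensorGraph hD (by simp) (by simp))

end TensorId

/-! ### Compact perturbations of Fredholm operators -/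

section Fredholm

open ContinuousLinearMap
open scoped LinearMap.FiniteRangeSetoid

variable {𝕜 X F : Type*} [RCLike 𝕜] [NormedAddCommGroup X] [NormedSpace 𝕜 X]

section Hilbert

variable [NormedAddCommGroup F] [InnerProductSpace 𝕜 F]

theorem exists_hasFiniteRange_norm_sub_le {k : X →L[𝕜] F} (hk : IsCompactOperator k) {ε : ℝ}
    (hε : 0 < ε) : ∃ f : X →L[𝕜] F, f.toLinearMap.HasFiniteRange ∧ ‖k - f‖ ≤ ε := by
  obtain ⟨C, hC, hCk⟩ := hk.image_closedBall_subset_compact (f := k.toLinearMap) 1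
  obtain ⟨t, ht, hCt⟩ := Metric.totallyBounded_iff.1 hC.totallyBounded ε hε
  let V : Submodule 𝕜 F := Submodule.span 𝕜 t
  have hV : FiniteDimensional 𝕜 V := FiniteDimensional.span_of_finite 𝕜 ht
  refine ⟨V.starProjection ∘L k, ?_, opNorm_le_of_unit_norm hε.le fun x hx => ?_⟩
  · have hfin : (V.starProjection : F →L[𝕜] F).toLinearMap.HasFiniteRange := by
      rw [LinearMap.hasFiniteRange_iff_range, Submodule.range_starProjection]
      exact (Submodule.fg_iff_finiteDimensional _).2 hV
    exact hfin.comp_right k.toLinearMap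
  · obtain ⟨y, hy, hxy⟩ := mem_iUnion₂.1 (hCt (hCk ⟨x, by simp [hx], rfl⟩))
    calc ‖k x - V.starProjection (k x)‖ = ⨅ w : V, ‖k x - w‖ := V.starProjection_minimal _
      _ ≤ ‖k x - y‖ := ciInf_le ⟨0, forall_mem_range.2 fun _ => norm_nonneg _⟩
        (⟨y, Submodule.subset_span hy⟩ : V)
      _ ≤ ε := (mem_ball_iff_norm.1 hxy).le

end Hilbert

section Banach

variable [NormedAddCommGroup F] [NormedSpace 𝕜 F] {u : X →L[𝕜] F}

theorem isFredholm_add_of_hasFiniteRange (hu : IsFredholm u) {f : X →L[𝕜] F}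
    (hf : f.toLinearMap.HasFiniteRange) : IsFredholm (u + f) := by
  obtain ⟨v, hv⟩ := hu.exists_isQuasiInverse
  refine .of_isQuasiInverse (v := v) (hv.congr (Setoid.refl _) ?_)
  rw [LinearMap.FiniteRangeSetoid.equiv_iff_hasFiniteRange]
  simpa using hf

variable [CompleteSpace X]

theorem isFredholm_add_of_norm_mul_lt_one {v : F →L[𝕜] X} (hv : v.IsQuasiInverse u)
    {s : X →L[𝕜] F} (hs : ‖v‖ * ‖s‖ < 1) : IsFredholm (u + s) := by
  -- `u + s` agrees with `u ∘ (1 + v ∘ s)` up to finite rank, and `1 + v ∘ s` is invertible.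
  obtain ⟨a, ha⟩ : IsUnit (1 + v ∘L s) := by
    rw [← sub_neg_eq_add]
    exact isUnit_one_sub_of_norm_lt_one (norm_neg (v ∘L s) ▸ (opNorm_comp_le _ _).trans_lt hs)
  let e : X ≃L[𝕜] X := ContinuousLinearEquiv.ofUnit a
  refine .of_isQuasiInverse (v := e.symm.toContinuousLinearMap ∘L v)
    ((e.toLinearEquiv.isQuasiInverse.comp hv).congr (Setoid.refl _) ?_)
  have huv := (LinearMap.FiniteRangeSetoid.equiv_iff_hasFiniteRange.1 hv.2.equiv).comp_right
    s.toLinearMap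
  rw [LinearMap.FiniteRangeSetoid.equiv_iff_hasFiniteRange]
  have hdiff : (u + s).toLinearMap - u.toLinearMap ∘ₗ e.toLinearMap =
      -((u.toLinearMap ∘ₗ v.toLinearMap - LinearMap.id) ∘ₗ s.toLinearMap) := by
    refine LinearMap.ext fun x => ?_
    have hex : e x = x + v (s x) := DFunLike.congr_fun ha x
    change u x + s x - u (e x) = -(u (v (s x)) - s x)
    rw [hex, map_add]
    abel
  exact hdiff ▸ huv.neg

theorem isFredholm_of_isClosed_range [CompleteSpace F]
    (hker : FiniteDimensional 𝕜 u.toLinearMap.ker)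
    (hclosed : IsClosed (u.toLinearMap.range : Set F))
    (hcoker : FiniteDimensional 𝕜 (F ⧸ u.toLinearMap.range)) : IsFredholm u where
  isStrictMap := by
    have : CompleteSpace u.toLinearMap.range := hclosed.completeSpace_coe
    let w : X →L[𝕜] u.toLinearMap.range := u.codRestrict _ fun x => ⟨x, rfl⟩
    have hw : Function.Surjective w := by
      rintro ⟨_, x, rfl⟩
      exact ⟨x, rfl⟩
    exact (w.isOpenMap hw).isQuotientMap w.continuous hw
  isClosed_range := hclosed
  finite_ker := hker
  finite_coker := hcoker
  closedComplemented_ker := Submodule.ClosedComplemented.of_finiteDimensional _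

end Banach

theorem isFredholm_add_of_isCompactOperator [CompleteSpace X] [NormedAddCommGroup F]
    [InnerProductSpace 𝕜 F] {u k : X →L[𝕜] F} (hu : IsFredholm u) (hk : IsCompactOperator k) :
    IsFredholm (u + k) := by
  obtain ⟨v, hv⟩ := hu.exists_isQuasiInverse
  obtain ⟨f, hf, hkf⟩ := exists_hasFiniteRange_norm_sub_le hk (ε := (‖v‖ + 1)⁻¹) (by positivity)
  have hsmall : ‖v‖ * ‖k - f‖ < 1 := calc
    ‖v‖ * ‖k - f‖ ≤ ‖v‖ * (‖v‖ + 1)⁻¹ := by gcongr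
    _ < 1 := by
      rw [mul_inv_lt_iff₀ (by positivity)]
      linarith
  rw [← sub_add_cancel k f, ← add_assoc]
  exact isFredholm_add_of_hasFiniteRange (isFredholm_add_of_norm_mul_lt_one hv hsmall) hf

end Fredholm

section EssentialSpectrum

open ContinuousLinearMap

/-- The isomorphism `x ↦ (x, A x)` from the domain of an operator onto its graph, which turns an
unbounded operator into a bounded one on the graph. -/
def domainEquivGraph {R E F : Type*} [Ring R] [AddCommGroup E] [Module R E] [AddCommGroup F]
    [Module R F] (A : E →ₗ.[R] F) : A.domain ≃ₗ[R] A.graph where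
  toFun x := ⟨(x, A x), A.mem_graph x⟩
  map_add' x y := Subtype.ext (Prod.ext rfl (A.map_add x y))
  map_smul' c x := Subtype.ext (Prod.ext rfl (A.map_smul c x))
  invFun p := ⟨p.1.1, LinearPMap.mem_domain_of_mem_graph p.2⟩
  left_inv _ := rfl
  right_inv p := Subtype.ext (Prod.ext rfl (A.mem_graph_snd_inj (A.mem_graph _) p.2 rfl))

variable {E : Type*} [NormedAddCommGroup E] [InnerProductSpace ℂ E] {A : E →ₗ.[ℂ] E}

/-- The operator `A + T` as the bounded operator `(x, A x) ↦ A x + T x` on the graph of `A`. -/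
def graphAdd (A : E →ₗ.[ℂ] E) (T : E →L[ℂ] E) : A.graph →L[ℂ] E :=
  (ContinuousLinearMap.snd ℂ E E + T ∘L ContinuousLinearMap.fst ℂ E E) ∘L A.graph.subtypeL

theorem toFun_vadd_sub_smul (B : E →L[ℂ] E) (z : ℂ) :
    ((B : E →ₗ[ℂ] E) +ᵥ A).toFun - z • ((B : E →ₗ[ℂ] E) +ᵥ A).domain.subtype =
      (graphAdd A (B - z • 1)).toLinearMap ∘ₗ (domainEquivGraph A).toLinearMap := by
  ext x
  change B x + A x - z • (x : E) = A x + (B x - z • (x : E))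
  abel

theorem notMem_essSpectrum_vadd_iff [CompleteSpace E] (hA : A.IsClosed) (B : E →L[ℂ] E) (z : ℂ) :
    z ∉ essSpectrum ((B : E →ₗ[ℂ] E) +ᵥ A) ↔ IsFredholm (graphAdd A (B - z • 1)) := by
  have : CompleteSpace A.graph :=
    (show _root_.IsClosed (A.graph : Set (E × E)) from hA).completeSpace_coe
  let e := domainEquivGraph A
  let S := graphAdd A (B - z • 1)
  have hess : z ∉ essSpectrum ((B : E →ₗ[ℂ] E) +ᵥ A) ↔
      FiniteDimensional ℂ (S.toLinearMap ∘ₗ e.toLinearMap).ker ∧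
      IsClosed ((S.toLinearMap ∘ₗ e.toLinearMap).range : Set E) ∧
      FiniteDimensional ℂ (E ⧸ (S.toLinearMap ∘ₗ e.toLinearMap).range) := by
    rw [essSpectrum, mem_ofPred_eq, not_not, toFun_vadd_sub_smul]
    rfl
  have hker : FiniteDimensional ℂ (S.toLinearMap ∘ₗ e.toLinearMap).ker ↔
      FiniteDimensional ℂ S.toLinearMap.ker := by
    refine Module.Finite.equiv_iff (e.ofSubmodules _ _ ?_)
    rw [LinearMap.ker_comp]
    exact Submodule.map_comap_eq_of_surjective e.surjective _
  rw [hess, LinearEquiv.range_comp, hker]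
  exact ⟨fun h => isFredholm_of_isClosed_range h.1 h.2.1 h.2.2,
    fun h => ⟨h.finite_ker, h.isClosed_range, h.finite_coker⟩⟩

theorem essSpectrum_vadd_of_isCompactOperator [CompleteSpace E] (hA : A.IsClosed) {B : E →L[ℂ] E}
    (hB : IsCompactOperator B) : essSpectrum ((B : E →ₗ[ℂ] E) +ᵥ A) = essSpectrum A := by
  have : CompleteSpace A.graph :=
    (show _root_.IsClosed (A.graph : Set (E × E)) from hA).completeSpace_coe
  let k : A.graph →L[ℂ] E := B ∘L ContinuousLinearMap.fst ℂ E E ∘L A.graph.subtypeL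
  have hk : IsCompactOperator k :=
    hB.comp_clm (ContinuousLinearMap.fst ℂ E E ∘L A.graph.subtypeL)
  ext z
  have hadd : graphAdd A (B - z • 1) = graphAdd A (0 - z • 1) + k := by
    refine ContinuousLinearMap.ext fun p => ?_
    change p.1.2 + (B p.1.1 - z • p.1.1) = p.1.2 + (0 - z • p.1.1) + B p.1.1
    abel
  have hzero : z ∉ essSpectrum A ↔ IsFredholm (graphAdd A (0 - z • 1)) := by
    rw [← notMem_essSpectrum_vadd_iff hA, ContinuousLinearMap.toLinearMap_zero, zero_vadd]
  rw [← not_iff_not, hzero, notMem_essSpectrum_vadd_iff hA, hadd]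
  refine ⟨fun h => ?_, fun h => isFredholm_add_of_isCompactOperator h hk⟩
  simpa using isFredholm_add_of_isCompactOperator (k := -k) h hk.neg

end EssentialSpectrum

/-! ### The momentum operator and the Hill operator -/

section TestFunctions

/-- The smooth compactly supported functions against which `IsWeakDeriv` is tested. -/
structure IsTestFunction (φ : ℝ → ℂ) : Prop where
  contDiff : ContDiff ℝ ∞ φ
  hasCompactSupport : HasCompactSupport φ

namespace IsTestFunction

variable {φ : ℝ → ℂ}

theorem deriv (hφ : IsTestFunction φ) : IsTestFunction (deriv φ) :=
  ⟨(contDiff_infty_iff_deriv.1 hφ.contDiff).2, hφ.hasCompactSupport.deriv⟩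

theorem hasDerivAt (hφ : IsTestFunction φ) (x : ℝ) : HasDerivAt φ (_root_.deriv φ x) x :=
  ((contDiff_infty_iff_deriv.1 hφ.contDiff).1 x).hasDerivAt

theorem conj (hφ : IsTestFunction φ) : IsTestFunction fun y => (starRingEnd ℂ) (φ y) :=
  ⟨Complex.conjCLE.contDiff.comp hφ.contDiff, hφ.hasCompactSupport.comp_left (map_zero _)⟩

theorem deriv_conj (hφ : IsTestFunction φ) :
    _root_.deriv (fun y => (starRingEnd ℂ) (φ y)) =
      fun y => (starRingEnd ℂ) (_root_.deriv φ y) :=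
  funext fun y => (Complex.conjCLE.toContinuousLinearMap.hasFDerivAt.comp_hasDerivAt y
    (hφ.hasDerivAt y)).deriv

theorem comp_sub_left (hφ : IsTestFunction φ) (s : ℝ) : IsTestFunction fun y => φ (s - y) :=
  ⟨hφ.contDiff.comp (contDiff_const.sub contDiff_id),
    hφ.hasCompactSupport.comp_homeomorph (Homeomorph.subLeft s)⟩

theorem memLp (hφ : IsTestFunction φ) : MemLp φ 2 :=
  hφ.contDiff.continuous.memLp_of_hasCompactSupport hφ.hasCompactSupport

/-- The class in `L²(ℝ)` of a test function. -/
def toLp (hφ : IsTestFunction φ) : L2R :=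
  hφ.memLp.toLp φ

theorem coeFn_toLp (hφ : IsTestFunction φ) : hφ.toLp =ᵐ[volume] φ :=
  hφ.memLp.coeFn_toLp

theorem inner_toLp (hφ : IsTestFunction φ) (f : L2R) :
    ⟪hφ.toLp, f⟫_ℂ = ∫ y, f y * (starRingEnd ℂ) (φ y) := by
  rw [L2.inner_def]
  refine integral_congr_ae (hφ.coeFn_toLp.mono fun y hy => ?_)
  simp only [hy, RCLike.inner_apply]

theorem integral_mul_deriv {χ : ℝ → ℂ} (hφ : IsTestFunction φ) (hχ : IsTestFunction χ) :
    ∫ y, φ y * _root_.deriv χ y = -∫ y, _root_.deriv φ y * χ y :=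
  integral_mul_deriv_eq_deriv_mul_of_integrable (fun x _ => hφ.hasDerivAt x)
    (fun x _ => hχ.hasDerivAt x) (hφ.memLp.integrable_mul hχ.deriv.memLp)
    (hφ.deriv.memLp.integrable_mul hχ.memLp) (hφ.memLp.integrable_mul hχ.memLp)

theorem integral_coeFn_toLp_mul (hφ : IsTestFunction φ) (g : ℝ → ℂ) :
    ∫ y, hφ.toLp y * g y = ∫ y, φ y * g y :=
  integral_congr_ae (hφ.coeFn_toLp.mul (ae_eq_refl g))

theorem isWeakDeriv_toLp (hφ : IsTestFunction φ) : IsWeakDeriv hφ.toLp hφ.deriv.toLp := by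
  intro χ hχ hχs
  rw [integral_coeFn_toLp_mul, integral_coeFn_toLp_mul]
  exact hφ.integral_mul_deriv ⟨hχ, hχs⟩

end IsTestFunction

end TestFunctions

section WeakDerivative

theorem isWeakDeriv_iff_inner {f g : L2R} : IsWeakDeriv f g ↔
    ∀ (φ : ℝ → ℂ) (hφ : IsTestFunction φ), ⟪hφ.deriv.toLp, f⟫_ℂ = -⟪hφ.toLp, g⟫_ℂ := by
  simp only [IsTestFunction.inner_toLp]
  refine ⟨fun h φ hφ => ?_, fun h φ hφ hs => ?_⟩
  · rw [← h _ hφ.conj.contDiff hφ.conj.hasCompactSupport, hφ.deriv_conj]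
  · have hφ' : IsTestFunction φ := ⟨hφ, hs⟩
    simpa only [hφ'.deriv_conj, Complex.conj_conj] using h _ hφ'.conj

theorem integral_coeFn_smul_mul (c : ℂ) (f : L2R) (φ : ℝ → ℂ) :
    ∫ y, (c • f : L2R) y * φ y = c * ∫ y, f y * φ y := by
  rw [← integral_const_mul]
  refine integral_congr_ae ((Lp.coeFn_smul c f).mono fun y hy => ?_)
  simp only [hy, Pi.smul_apply, smul_eq_mul, mul_assoc]

theorem eq_zero_of_integral_mul_eq_zero {f : L2R}
    (h : ∀ φ, IsTestFunction φ → ∫ y, f y * φ y = 0) : f = 0 := by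
  refine IsWeakDeriv.eq_zero fun φ hφ hs => ?_
  rw [h φ ⟨hφ, hs⟩, ← zero_smul ℂ (0 : L2R), integral_coeFn_smul_mul, zero_mul, neg_zero]

theorem eq_zero_of_hasDerivAt_smul_of_norm_le {E : Type*} [NormedAddCommGroup E] [NormedSpace ℂ E]
    {u : ℝ → E} {c : ℂ} {C : ℝ} (hc : c.re ≠ 0) (hu : ∀ s, HasDerivAt u (c • u s) s)
    (hC : ∀ s, ‖u s‖ ≤ C) : u 0 = 0 := by
  let v : ℝ → E := fun s => Complex.exp (-c * s) • u s
  have hexp : ∀ s : ℝ, HasDerivAt (fun s : ℝ => Complex.exp (-c * s))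
      (Complex.exp (-c * s) * (-c * 1)) s := fun s =>
    (((hasDerivAt_id s).ofReal_comp).const_mul (-c)).cexp
  have hv : ∀ s, HasDerivAt v 0 s := fun s =>
    ((hexp s).smul (hu s)).congr_deriv (by module)
  have hbound : ∀ t, ‖u 0‖ ≤ Real.exp (-t) * C := fun t => calc
    ‖u 0‖ = ‖v (t / c.re)‖ := by
      rw [is_const_of_deriv_eq_zero (fun s => (hv s).differentiableAt) (fun s => (hv s).deriv)
        (t / c.re) 0]
      simp [v]
    _ = Real.exp (-t) * ‖u (t / c.re)‖ := by
      rw [norm_smul, Complex.norm_exp, Complex.re_mul_ofReal, Complex.neg_re, neg_mul,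
        mul_div_cancel₀ _ hc]
    _ ≤ Real.exp (-t) * C := by
      gcongr
      exact hC _
  refine norm_le_zero_iff.1 (ge_of_tendsto' (x := atTop) ?_ hbound)
  simpa using Real.tendsto_exp_neg_atTop_nhds_zero.mul_const C

theorem hasDerivAt_integral_mul_comp_sub_left (f : L2R) {φ : ℝ → ℂ} (hφ : IsTestFunction φ)
    (s : ℝ) : HasDerivAt (fun s => ∫ y, f y * φ (s - y)) (∫ y, f y * deriv φ (s - y)) s :=
  hφ.hasCompactSupport.hasDerivAt_convolution_right (ContinuousLinearMap.mul ℝ ℂ)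
    ((Lp.memLp f).locallyIntegrable one_le_two) (hφ.contDiff.of_le (by simp)) s

theorem norm_integral_mul_comp_sub_left_le (f : L2R) {φ : ℝ → ℂ} (hφ : IsTestFunction φ) (s : ℝ) :
    ‖∫ y, f y * φ (s - y)‖ ≤ (∫ y, ‖f y‖ ^ 2) + ∫ y, ‖φ y‖ ^ 2 := by
  have hf : Integrable fun y => ‖f y‖ ^ 2 := (Lp.memLp f).integrable_norm_pow two_ne_zero
  have hφs : Integrable fun y => ‖φ (s - y)‖ ^ 2 :=
    (hφ.comp_sub_left s).memLp.integrable_norm_pow two_ne_zero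
  rw [← integral_sub_left_eq_self (fun y => ‖φ y‖ ^ 2) volume s, ← integral_add hf hφs]
  refine norm_integral_le_of_norm_le (hf.add hφs) (Eventually.of_forall fun y => ?_)
  rw [norm_mul]
  nlinarith [two_mul_le_add_sq ‖f y‖ ‖φ (s - y)‖, sq_nonneg ‖f y‖, sq_nonneg ‖φ (s - y)‖]

/-- Mollifying `f` gives bounded classical solutions of `u' = c u`, which vanish. -/
theorem IsWeakDeriv.eq_zero_of_smul {f : L2R} {c : ℂ} (hc : c.re ≠ 0)
    (hf : IsWeakDeriv f (c • f)) : f = 0 := by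
  refine eq_zero_of_integral_mul_eq_zero fun ψ hψ => ?_
  have hφ : IsTestFunction fun y => ψ (0 - y) := hψ.comp_sub_left 0
  set φ : ℝ → ℂ := fun y => ψ (0 - y)
  have hu : ∀ s, HasDerivAt (fun s => ∫ y, f y * φ (s - y)) (c • ∫ y, f y * φ (s - y)) s := by
    intro s
    have hφs := hφ.comp_sub_left s
    have hderiv : ∫ y, f y * deriv φ (s - y) = c • ∫ y, f y * φ (s - y) := by
      have h := hf _ hφs.contDiff hφs.hasCompactSupport
      simpa only [deriv_comp_const_sub, mul_neg, integral_neg, neg_inj,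
        integral_coeFn_smul_mul, smul_eq_mul] using h
    exact hderiv ▸ hasDerivAt_integral_mul_comp_sub_left f hφ s
  simpa [φ] using eq_zero_of_hasDerivAt_smul_of_norm_le hc hu
    (norm_integral_mul_comp_sub_left_le f hφ)

end WeakDerivative

section Momentum

/-- The graph of the momentum operator `-i d/dy`, as the closure of its restriction to test
functions. -/
def momentumGraph : Submodule ℂ (L2R × L2R) :=
  (Submodule.span ℂ (Set.range fun φ : {φ // IsTestFunction φ} =>
    (φ.2.toLp, -Complex.I • φ.2.deriv.toLp))).topologicalClosure

theorem mem_adjoint_momentumGraph {q : L2R × L2R} :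
    q ∈ momentumGraph.adjoint ↔ IsWeakDeriv q.1 (Complex.I • q.2) := by
  simp only [momentumGraph, mem_adjoint_closure_span_iff, forall_mem_range, Subtype.forall,
    isWeakDeriv_iff_inner, inner_smul_left, inner_smul_right, map_neg, Complex.conj_I, neg_neg]
  refine forall₂_congr fun φ hφ => ⟨fun h => ?_, fun h => ?_⟩
  · rw [← h, ← mul_assoc, Complex.I_mul_I, neg_one_mul, neg_neg]
  · rw [h, mul_neg, ← mul_assoc, Complex.I_mul_I, neg_one_mul, neg_neg]

theorem momentumGraph_le_adjoint : momentumGraph ≤ momentumGraph.adjoint := by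
  refine Submodule.topologicalClosure_minimal _ (Submodule.span_le.2 ?_) (isClosed_adjoint _)
  rintro _ ⟨φ, rfl⟩
  refine mem_adjoint_momentumGraph.2 ?_
  rw [smul_smul, mul_neg, Complex.I_mul_I, neg_neg, one_smul]
  exact φ.2.isWeakDeriv_toLp

theorem orthogonal_rangeAdd_momentumGraph {c : ℂ} (hc : c.im ≠ 0) :
    (rangeAdd momentumGraph c)ᗮ = ⊥ := by
  refine (Submodule.eq_bot_iff _).2 fun v hv => ?_
  rw [mem_orthogonal_rangeAdd, mem_adjoint_momentumGraph, smul_smul] at hv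
  exact hv.eq_zero_of_smul (by simpa using hc)

theorem adjoint_momentumGraph : momentumGraph.adjoint = momentumGraph :=
  adjoint_eq_of_orthogonal_rangeAdd_eq_bot (Submodule.isClosed_topologicalClosure _)
    momentumGraph_le_adjoint (orthogonal_rangeAdd_momentumGraph (by simp))
    (orthogonal_rangeAdd_momentumGraph (by simp))

theorem mem_momentumGraph {q : L2R × L2R} :
    q ∈ momentumGraph ↔ IsWeakDeriv q.1 (Complex.I • q.2) := by
  rw [← mem_adjoint_momentumGraph, adjoint_momentumGraph]

end Momentum

section Hill

theorem graph_hillOperator (U : ℝ → ℝ) : (hillOperator U).graph = hillGraph U :=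
  Submodule.toLinearPMap_graph_eq _ (hillGraph_single_valued U)

theorem mem_hillGraph_zero {q : L2R × L2R} :
    q ∈ hillGraph 0 ↔ ∃ g, IsWeakDeriv q.1 g ∧ IsWeakDeriv g (-q.2) := by
  have hae : ∀ h : L2R, q.2 =ᵐ[volume] (fun y => -h y + (((0 : ℝ → ℝ) y : ℝ) : ℂ) * q.1 y) ↔
      h = -q.2 := fun h => by
    rw [← neg_eq_iff_eq_neg, eq_comm, Lp.ext_iff]
    simp only [Pi.zero_apply, Complex.ofReal_zero, zero_mul, add_zero]
    exact ⟨fun hq => hq.trans (Lp.coeFn_neg h).symm, fun hq => hq.trans (Lp.coeFn_neg h)⟩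
  refine exists_congr fun g => ⟨?_, fun ⟨hg, hh⟩ => ⟨_, hg, hh, (hae _).2 rfl⟩⟩
  rintro ⟨h, hg, hh, hq⟩
  exact ⟨hg, (hae h).1 hq ▸ hh⟩

theorem hillGraph_zero : hillGraph 0 = sqRel momentumGraph := by
  ext q
  rw [mem_hillGraph_zero]
  change _ ↔ ∃ y, (q.1, y) ∈ momentumGraph ∧ (y, q.2) ∈ momentumGraph
  simp only [mem_momentumGraph]
  constructor
  · rintro ⟨g, hg, hh⟩
    refine ⟨-Complex.I • g, ?_, ?_⟩
    · rwa [smul_smul, mul_neg, Complex.I_mul_I, neg_neg, one_smul]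
    · simpa using hh.smul (-Complex.I)
  · rintro ⟨y, hy, hq⟩
    exact ⟨Complex.I • y, hy, by simpa [smul_smul] using hq.smul Complex.I⟩

theorem isSelfAdjoint_hillOperator_zero : IsSelfAdjoint (hillOperator 0) := by
  rw [isSelfAdjoint_iff_adjoint_graph_eq, graph_hillOperator, hillGraph_zero]
  exact adjoint_sqRel_eq adjoint_momentumGraph

theorem memLp_top_of_continuous_of_periodic {E : Type*} [NormedAddCommGroup E]
    {f : ℝ → E} {c : ℝ} (hf : Continuous f) (hfc : Function.Periodic f c) (hc : c ≠ 0)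
    {μ : Measure ℝ} : MemLp f ⊤ μ := by
  obtain ⟨C, hC⟩ := (hfc.isBounded_of_continuous hc hf).exists_norm_le
  exact memLp_top_of_bound hf.aestronglyMeasurable C (ae_of_all _ fun x => hC _ ⟨x, rfl⟩)

variable {U : ℝ → ℝ}

/-- Multiplication by an essentially bounded real function on `L²(ℝ)`. -/
def mulBounded (hU : MemLp U ⊤) : L2R →L[ℂ] L2R :=
  (ContinuousLinearMap.mul ℂ ℂ).holderL volume ⊤ 2 2 (hU.ofReal (K := ℂ)).toLp

theorem coeFn_mulBounded (hU : MemLp U ⊤) (f : L2R) :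
    mulBounded hU f =ᵐ[volume] fun y => (U y : ℂ) * f y := by
  filter_upwards [(ContinuousLinearMap.mul ℂ ℂ).coeFn_holder (r := 2) hU.ofReal.toLp f,
    (hU.ofReal (K := ℂ)).coeFn_toLp] with y hy hUy
  exact hy.trans (congrArg (· * f y) hUy)

theorem isSymmetric_mulBounded (hU : MemLp U ⊤) :
    (mulBounded hU : L2R →ₗ[ℂ] L2R).IsSymmetric := by
  intro f g
  change ⟪mulBounded hU f, g⟫_ℂ = ⟪f, mulBounded hU g⟫_ℂ
  rw [L2.inner_def, L2.inner_def]
  refine integral_congr_ae ?_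
  filter_upwards [coeFn_mulBounded hU f, coeFn_mulBounded hU g] with y hf hg
  rw [hf, hg, RCLike.inner_apply, RCLike.inner_apply, map_mul, Complex.conj_ofReal]
  ring

theorem hillOperator_eq_vadd (hU : MemLp U ⊤) :
    hillOperator U = (mulBounded hU : L2R →ₗ[ℂ] L2R) +ᵥ hillOperator 0 := by
  refine LinearPMap.eq_of_eq_graph ?_
  ext q
  rw [mem_graph_vadd, graph_hillOperator, graph_hillOperator]
  refine exists_congr fun g => exists_congr fun h => and_congr_right fun _ =>
    and_congr_right fun _ => ?_
  change _ ↔ (q.2 - mulBounded hU q.1 : L2R) =ᵐ[volume] _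
  constructor <;> intro hq <;>
    filter_upwards [hq, coeFn_mulBounded hU q.1, Lp.coeFn_sub q.2 (mulBounded hU q.1)]
      with y hy hm hsub
  · rw [hsub, Pi.sub_apply, hm, hy]
    simp
  · rw [hsub, Pi.sub_apply, hm, sub_eq_iff_eq_add] at hy
    simpa using hy

theorem isSelfAdjoint_qInf (hU : MemLp U ⊤) (Estar : ℝ) : IsSelfAdjoint (qInf U Estar) := by
  have hE : (-((Estar : ℂ) • LinearMap.id) : L2R →ₗ[ℂ] L2R).IsSymmetric := fun f g => by
    change ⟪-((Estar : ℂ) • f), g⟫_ℂ = ⟪f, -((Estar : ℂ) • g)⟫_ℂ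
    rw [inner_neg_left, inner_neg_right, inner_smul_left, inner_smul_right, Complex.conj_ofReal]
  rw [qInf, hillOperator_eq_vadd hU]
  exact isSelfAdjoint_vadd
    (isSelfAdjoint_vadd isSelfAdjoint_hillOperator_zero (isSymmetric_mulBounded hU)) hE

end Hill

/-! ### Hecke operators and the mass operator -/

section Hecke

theorem rho_one (f : L2X) : rho 1 f = f := by
  refine (rho 1).injective ?_
  rw [rho_mul, one_mul]

theorem inner_rho_left (g : Ideles) (f h : L2X) : ⟪rho g f, h⟫_ℂ = ⟪f, rho g⁻¹ h⟫_ℂ := by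
  rw [← (rho g⁻¹).inner_map_map, rho_mul, inv_mul_cancel, rho_one]

theorem isSelfAdjoint_heckeOperator (Φ₀ : L2X) (p : PrimeNumber) :
    IsSelfAdjoint (heckeOperator Φ₀ p) := by
  rw [ContinuousLinearMap.isSelfAdjoint_iff_isSymmetric]
  intro f g
  change ⟪rho (uniformizer p) (f : L2X) + rho (uniformizer p)⁻¹ (f : L2X), (g : L2X)⟫_ℂ =
    ⟪(f : L2X), rho (uniformizer p) (g : L2X) + rho (uniformizer p)⁻¹ (g : L2X)⟫_ℂ
  rw [inner_add_left, inner_add_right, inner_rho_left, inner_rho_left, inv_inv, add_comm]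

end Hecke

section Mass

variable {H : Type*} [NormedAddCommGroup H] [InnerProductSpace ℂ H]

theorem isSymmetric_chiralCLM {M : H →L[ℂ] H} (hM : M.IsSymmetric) :
    (chiralCLM M).IsSymmetric := fun x y =>
  (congrArg₂ (· + ·) (hM x.snd y.fst) (hM x.fst y.snd)).trans (add_comm _ _)

theorem norm_chiralCLM_le (M : H →L[ℂ] H) : ‖chiralCLM M‖ ≤ ‖M‖ := by
  refine ContinuousLinearMap.opNorm_le_bound _ (norm_nonneg _) fun x => ?_
  refine le_of_sq_le_sq ?_ (by positivity)
  calc ‖chiralCLM M x‖ ^ 2 = ‖M x.snd‖ ^ 2 + ‖M x.fst‖ ^ 2 := WithLp.prod_norm_sq_eq_of_L2 _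
    _ ≤ (‖M‖ * ‖x.snd‖) ^ 2 + (‖M‖ * ‖x.fst‖) ^ 2 := by gcongr <;> exact M.le_opNorm _
    _ = (‖M‖ * ‖x‖) ^ 2 := by rw [mul_pow _ ‖x‖, WithLp.prod_norm_sq_eq_of_L2 x]; ring

theorem isCompactOperator_chiralCLM {M : H →L[ℂ] H} (hM : IsCompactOperator M) :
    IsCompactOperator (chiralCLM M) := by
  have hinl := (hM.comp_clm (WithLp.sndL 2 ℂ H H)).clm_comp (ContinuousLinearMap.inl ℂ H H)
  have hinr := (hM.comp_clm (WithLp.fstL 2 ℂ H H)).clm_comp (ContinuousLinearMap.inr ℂ H H)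
  refine (congrArg IsCompactOperator (funext fun x => ?_)).mpr ((hinl.add hinr).clm_comp
    (WithLp.prodContinuousLinearEquiv 2 ℂ H H).symm.toContinuousLinearMap)
  exact WithLp.ofLp_injective 2
    (Prod.ext (add_zero (M x.snd)).symm (zero_add (M x.fst)).symm)

variable [CompleteSpace H]

theorem inner_borelCalculus_self (T : H →L[ℂ] H) {η : ℝ → ℝ} (hη : Measurable η) {C : ℝ}
    (hC : ∀ t, |η t| ≤ C) (x : H) : ⟪borelCalculus T η x, x⟫_ℂ = (spectralForm T η x : ℂ) := by
  rw [← inner_conj_symm, inner_borelCalculus T hη hC, Complex.conj_ofReal, spectralForm]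

theorem isSymmetric_borelCalculus (T : H →L[ℂ] H) {η : ℝ → ℝ} (hη : Measurable η) {C : ℝ}
    (hC : ∀ t, |η t| ≤ C) : (borelCalculus T η).IsSymmetric := by
  refine (LinearMap.isSymmetric_iff_inner_map_self_real _).2 fun x => ?_
  simp only [ContinuousLinearMap.coe_coe, inner_borelCalculus_self T hη hC, Complex.conj_ofReal]

theorem norm_borelCalculus_le (T : H →L[ℂ] H) {η : ℝ → ℝ} (hη : Measurable η) {C : ℝ}
    (hC : ∀ t, |η t| ≤ C) : ‖borelCalculus T η‖ ≤ C := by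
  rw [ContinuousLinearMap.norm_eq_iSup_rayleighQuotient _ (isSymmetric_borelCalculus T hη hC)]
  refine ciSup_le fun x => ?_
  rw [ContinuousLinearMap.rayleighQuotient, ContinuousLinearMap.reApplyInnerSelf_apply,
    inner_borelCalculus_self T hη hC, RCLike.re_to_complex, Complex.ofReal_re, abs_div,
    abs_of_nonneg (sq_nonneg ‖x‖)]
  exact div_le_of_le_mul₀ (sq_nonneg _) ((abs_nonneg _).trans (hC 0)) (abs_spectralForm_le T hC x)

variable {T : PrimeNumber → H →L[ℂ] H} {η : PrimeNumber → ℝ → ℝ}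

theorem summable_massTerm (hη : ∀ p, Measurable (η p))
    (hb : ∀ p, BddAbove (Set.range fun t => |η p t|)) (hs : Summable fun p => ⨆ t, |η p t|) :
    Summable (massTerm T η) :=
  Summable.of_norm_bounded hs fun p => (norm_chiralCLM_le _).trans
    (norm_borelCalculus_le (T p) (hη p) (le_ciSup (hb p)))

theorem isSelfAdjoint_massTerm {p : PrimeNumber} (hη : Measurable (η p))
    (hb : BddAbove (Set.range fun t => |η p t|)) : IsSelfAdjoint (massTerm T η p) :=
  ContinuousLinearMap.isSelfAdjoint_iff_isSymmetric.2
    (isSymmetric_chiralCLM (isSymmetric_borelCalculus (T p) hη (le_ciSup hb)))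

theorem isSelfAdjoint_massOperator (hη : ∀ p, Measurable (η p))
    (hb : ∀ p, BddAbove (Set.range fun t => |η p t|)) : IsSelfAdjoint (massOperator T η) :=
  (tsum_star (f := massTerm T η)).trans
    (tsum_congr fun p => isSelfAdjoint_massTerm (hη p) (hb p))

theorem isCompactOperator_massOperator (hs : Summable (massTerm T η))
    (hc : ∀ p, IsCompactOperator (borelCalculus (T p) (η p))) :
    IsCompactOperator (massOperator T η) :=
  isCompactOperator_of_tendsto hs.hasSum (Eventually.of_forall fun _ =>
    (compactOperator (RingHom.id ℂ) (Double H) (Double H)).sum_mem fun p _ =>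
      isCompactOperator_chiralCLM (hc p))

end Mass

section Phys

theorem isSelfAdjoint_dGlobPhys {K : Type*} [NormedAddCommGroup K] [InnerProductSpace ℂ K]
    (W : L2X ≃ₗᵢ[ℂ] HilbertTensor L2R K) {U : ℝ → ℝ} (hU : MemLp U ⊤ volume) (Estar : ℝ)
    (Φ₀ : L2X) (hred : IsReducedBy (physProj Φ₀) (dGlob W U Estar)) :
    IsSelfAdjoint (dGlobPhys W U Estar Φ₀) := by
  have hadj : (physIncl Φ₀).adjoint = diagCLM (HPhys Φ₀).orthogonalProjectionOnto := by
    rw [physIncl, adjoint_diagCLM, Submodule.adjoint_subtypeL]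
  refine isSelfAdjoint_part (isSelfAdjoint_tensorId (isSelfAdjoint_chiral
    (isSelfAdjoint_qInf hU Estar))) ?_ ?_
  · ext x : 1
    rw [hadj]
    exact WithLp.ofLp_injective 2
      (Prod.ext (Submodule.orthogonalProjectionOnto_mem_subspace_eq_self x.fst)
        (Submodule.orthogonalProjectionOnto_mem_subspace_eq_self x.snd))
  · rw [hadj]
    exact hred

end Phys

end AdelicDirac

end

theorem mainTheorem1_general {K : Type*} [NormedAddCommGroup K] [InnerProductSpace ℂ K]
    (W : AdelicDirac.L2X ≃ₗᵢ[ℂ] AdelicDirac.HilbertTensor AdelicDirac.L2R K)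
    (U : ℝ → ℝ) (hU : MemLp U ⊤ volume) (Estar : ℝ) (Φ₀ : AdelicDirac.L2X)
    (hred : AdelicDirac.IsReducedBy (AdelicDirac.physProj Φ₀) (AdelicDirac.dGlob W U Estar)) :
    (∀ p, IsSelfAdjoint (AdelicDirac.heckeOperator Φ₀ p)) ∧
    ∀ (T : AdelicDirac.PrimeNumber → AdelicDirac.HPhys Φ₀ →L[ℂ] AdelicDirac.HPhys Φ₀)
      (_ : ∀ p, IsSelfAdjoint (T p))
      (η : AdelicDirac.PrimeNumber → ℝ → ℝ) (_ : ∀ p, Measurable (η p))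
      (_ : ∀ p, BddAbove (Set.range fun t => |η p t|))
      (_ : Summable fun p => ⨆ t, |η p t|),
      Summable (AdelicDirac.massTerm T η) ∧
      IsSelfAdjoint (AdelicDirac.massOperator T η) ∧
      Dense ((AdelicDirac.dArith W U Estar Φ₀ T η).domain :
        Set (AdelicDirac.Double (AdelicDirac.HPhys Φ₀))) ∧
      IsSelfAdjoint (AdelicDirac.dArith W U Estar Φ₀ T η) ∧
      ((∀ p, IsCompactOperator (AdelicDirac.borelCalculus (T p) (η p))) →
        IsCompactOperator (AdelicDirac.massOperator T η) ∧
        AdelicDirac.essSpectrum (AdelicDirac.dArith W U Estar Φ₀ T η) =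
          AdelicDirac.essSpectrum (AdelicDirac.dGlobPhys W U Estar Φ₀)) := by
  refine ⟨AdelicDirac.isSelfAdjoint_heckeOperator Φ₀, fun T _ η hη hb hsum => ?_⟩
  have hseries := AdelicDirac.summable_massTerm (T := T) hη hb hsum
  have hmass := AdelicDirac.isSelfAdjoint_massOperator (T := T) hη hb
  have hglob := AdelicDirac.isSelfAdjoint_dGlobPhys W hU Estar Φ₀ hred
  have harith : IsSelfAdjoint (AdelicDirac.dArith W U Estar Φ₀ T η) :=
    AdelicDirac.isSelfAdjoint_vadd hglob (ContinuousLinearMap.isSelfAdjoint_iff_isSymmetric.1 hmass)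
  refine ⟨hseries, hmass, harith.dense_domain, harith, fun hcompact => ?_⟩
  have hmassCompact := AdelicDirac.isCompactOperator_massOperator hseries hcompact
  exact ⟨hmassCompact,
    AdelicDirac.essSpectrum_vadd_of_isCompactOperator hglob.isClosed hmassCompact⟩

theorem mainTheorem1 {K : Type*} [NormedAddCommGroup K] [InnerProductSpace ℂ K] [CompleteSpace K]
    (W : AdelicDirac.L2X ≃ₗᵢ[ℂ] AdelicDirac.HilbertTensor AdelicDirac.L2R K)
    (U : ℝ → ℝ) (hU : ContDiff ℝ ∞ U) (L : ℝ) (hL : 0 < L) (hUL : Function.Periodic U L)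
    (Estar : ℝ) (Φ₀ : AdelicDirac.L2X)
    (hred : AdelicDirac.IsReducedBy (AdelicDirac.physProj Φ₀) (AdelicDirac.dGlob W U Estar)) :
    (∀ p, IsSelfAdjoint (AdelicDirac.heckeOperator Φ₀ p)) ∧
    ∀ (T : AdelicDirac.PrimeNumber → AdelicDirac.HPhys Φ₀ →L[ℂ] AdelicDirac.HPhys Φ₀)
      (_ : ∀ p, IsSelfAdjoint (T p))
      (η : AdelicDirac.PrimeNumber → ℝ → ℝ) (_ : ∀ p, Measurable (η p))
      (_ : ∀ p, BddAbove (Set.range fun t => |η p t|))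
      (_ : Summable fun p => ⨆ t, |η p t|),
      Summable (AdelicDirac.massTerm T η) ∧
      IsSelfAdjoint (AdelicDirac.massOperator T η) ∧
      Dense ((AdelicDirac.dArith W U Estar Φ₀ T η).domain :
        Set (AdelicDirac.Double (AdelicDirac.HPhys Φ₀))) ∧
      IsSelfAdjoint (AdelicDirac.dArith W U Estar Φ₀ T η) ∧
      ((∀ p, IsCompactOperator (AdelicDirac.borelCalculus (T p) (η p))) →
        (Summable fun p => ‖AdelicDirac.borelCalculus (T p) (η p)‖) →
        IsCompactOperator (AdelicDirac.massOperator T η) ∧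
        AdelicDirac.essSpectrum (AdelicDirac.dArith W U Estar Φ₀ T η) =
          AdelicDirac.essSpectrum (AdelicDirac.dGlobPhys W U Estar Φ₀)) := by
  have h := mainTheorem1_general W U
    (AdelicDirac.memLp_top_of_continuous_of_periodic hU.continuous hUL hL.ne') Estar Φ₀ hred
  refine ⟨h.1, fun T hT η hη hb hsum => ?_⟩
  obtain ⟨hseries, hmass, hdense, harith, hcompact⟩ := h.2 T hT η hη hb hsum
  exact ⟨hseries, hmass, hdense, harith, fun hc _ => hcompact hc⟩
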